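/- Let $k$ be a field. A standard graded algebra over $k$ is a quotient $R=S/I$, where $S=k[x_1,\dots,x_r]$ ($r$ arbitrary) carries the standard grading and $I\subsetneq S$ is a homogeneous ideal. Let $\mathfrak m=(x_1,\dots,x_r)$, let $H^i_{\mathfrak m}(R)$ be the $i$-th local cohomology module, which is graded, put $a_i(R)=\max\{n\mid H^i_{\mathfrak m}(R)_n\neq 0\}$ (with $a_i(R)=-\infty$ if $H^i_{\mathfrak m}(R)=0$), and let $\operatorname{reg}(R)=\max\{a_i(R)+i\mid i\ge 0\}$ be the Castelnuovo–Mumford regularity. For a linear form $x\in R$ let $(x)^{sat}=\bigcup_{n}\big((x):_R \mathfrak m^n\big)$ be the saturation of the ideal $(x)$ of $R$. Define polynomials $F_p(X)\in\mathbb Q[X]$, $p\ge 1$, by $F_1(X)=X$ and, for $p\ge 2$, $$F_p(X)=F_{p-1}(X)+X\binom{F_{p-1}(X)+p-1}{p-1},$$ where $\binom{Y+q}{q}=\frac{(Y+q)(Y+q-1)\cdots(Y+1)}{q!}$. **Theorem.** Let $\mathcal C$ be a class of standard graded algebras over $k$ and let $t$ be an integer such that 1. $\operatorname{depth}(R)>0$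 for every $R\in\mathcal C$; 2. for every $R\in\mathcal C$ with $\dim R\ge 2$ there is a linear form $x\in R$ which is a regular element (a non-zero-divisor) of $R$ and for which $R/(x)^{sat}\in\mathcal C$; 3. $\dim_k H^1_{\mathfrak m}(R)_0\le t$ for every $R\in\mathcal C$. Then every $R\in\mathcal C$, with $d=\dim R$, satisfies $$\operatorname{reg}(R)\le F_d(t).$$ -/

import Mathlib

open MvPolynomial

namespace StdGraded

universe u v

noncomputable section

variable {k : Type u} [Field k] {r : ℕ}

/-- The maximal graded ideal `𝔪 = (x₁, …, x_r)` of `S = k[x₁, …, x_r]`. -/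
def maxIdeal (k : Type u) [Field k] (r : ℕ) : Ideal (MvPolynomial (Fin r) k) :=
  Ideal.span (Set.range X)

/-! ### Local cohomology of graded modules through the Čech complex -/

/-- The multiplicative set of all monomials in the variables `x_i`, `i ∈ σ`.  Inverting it is the
same as inverting the single element `∏ i ∈ σ, x_i`. -/
def monomials (k : Type u) [Field k] {r : ℕ} (σ : Finset (Fin r)) :
    Submonoid (MvPolynomial (Fin r) k) :=
  Submonoid.closure (X '' (σ : Set (Fin r)))

theorem monomials_mono {σ τ : Finset (Fin r)} (h : σ ⊆ τ) : monomials k σ ≤ monomials k τ :=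
  Submonoid.closure_mono (Set.image_mono (Finset.coe_subset.2 h))

section Module

variable (M : Type v) [AddCommGroup M] [Module (MvPolynomial (Fin r) k) M]

/-- The `p`-th term `⨁_{|σ| = p} M_{x_σ}` of the Čech complex of `M` on `x₁, …, x_r`, where
`x_σ = ∏ i ∈ σ, x_i`. -/
abbrev Cech (p : ℕ) : Type (max u v) :=
  (σ : {s : Finset (Fin r) // s.card = p}) → LocalizedModule (monomials k σ.1) M

/-- The Čech differential
`(d c)_τ = ∑_{i ∈ τ} (-1)^{#{j ∈ τ | j < i}} c_{τ \ {i}}|_{M_{x_τ}}`. -/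
def cechD (p : ℕ) : Cech (k := k) (r := r) M p →ₗ[MvPolynomial (Fin r) k]
    Cech (k := k) (r := r) M (p + 1) :=
  LinearMap.pi fun τ => ∑ i : {i // i ∈ τ.1},
    (-1 : ℤ) ^ (τ.1.filter (· < i.1)).card •
      (LocalizedModule.liftOfLE (M := M) _ _
          (monomials_mono (k := k) (Finset.erase_subset i.1 τ.1))).comp
        (LinearMap.proj (R := MvPolynomial (Fin r) k)
          (φ := fun σ : {s : Finset (Fin r) // s.card = p} =>
            LocalizedModule (monomials k σ.1) M)
          ⟨τ.1.erase i.1, by rw [Finset.card_erase_of_mem i.2, τ.2]; rfl⟩)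

variable {M}
variable [Module k M] [IsScalarTower k (MvPolynomial (Fin r) k) M]

/-- The part of degree `n` of the localization `M_{x_σ}` of a graded module `M = ⨁ ℳ n`: the
`k`-span of the fractions `m / u`, where `u` is a monomial of degree `e` in the inverted variables
and `m` is homogeneous of degree `n + e`. -/
def locDegree (ℳ : ℤ → Submodule k M) (σ : Finset (Fin r)) (n : ℤ) :
    Submodule k (LocalizedModule (monomials k σ) M) :=
  Submodule.span k {z | ∃ (e : ℕ) (u : monomials k σ) (m : M),
    u.1.IsHomogeneous e ∧ m ∈ ℳ (n + e) ∧ z = LocalizedModule.mk m u}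

/-- The part of degree `n` of the `p`-th term of the Čech complex. -/
def cechDegree (ℳ : ℤ → Submodule k M) (p : ℕ) (n : ℤ) :
    Submodule k (Cech (k := k) (r := r) M p) :=
  Submodule.pi Set.univ fun σ => locDegree ℳ σ.1 n

/-- Čech cocycles of degree `n` in cohomological position `p`. -/
def cocycles (r : ℕ) [Module (MvPolynomial (Fin r) k) M]
    [IsScalarTower k (MvPolynomial (Fin r) k) M] (ℳ : ℤ → Submodule k M) (p : ℕ) (n : ℤ) :
    Submodule k (Cech (k := k) (r := r) M p) :=
  cechDegree ℳ p n ⊓ LinearMap.ker ((cechD M p).restrictScalars k)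

/-- Čech coboundaries of degree `n` in cohomological position `p`. -/
def coboundaries (r : ℕ) [Module (MvPolynomial (Fin r) k) M]
    [IsScalarTower k (MvPolynomial (Fin r) k) M] (ℳ : ℤ → Submodule k M) :
    (p : ℕ) → (n : ℤ) → Submodule k (Cech (k := k) (r := r) M p)
  | 0, _ => ⊥
  | p + 1, n => (cechDegree ℳ p n).map ((cechD M p).restrictScalars k)

/-- The `k`-vector space `H^p_𝔪(M)_n`: the part of degree `n` of the `p`-th local cohomology of the
graded `k[x₁, …, x_r]`-module `M = ⨁ ℳ n` with support in `𝔪 = (x₁, …, x_r)`. -/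
abbrev localCoh (r : ℕ) [Module (MvPolynomial (Fin r) k) M]
    [IsScalarTower k (MvPolynomial (Fin r) k) M] (ℳ : ℤ → Submodule k M) (p : ℕ) (n : ℤ) :
    Type (max u v) :=
  cocycles r ℳ p n ⧸ (coboundaries r ℳ p n).submoduleOf (cocycles r ℳ p n)

/-- The Castelnuovo–Mumford regularity `max {a_i(M) + i | i ≥ 0}` with
`a_i(M) = max {n | H^i_𝔪(M)_n ≠ 0}`, as an extended real number. -/
def reg (r : ℕ) [Module (MvPolynomial (Fin r) k) M]
    [IsScalarTower k (MvPolynomial (Fin r) k) M] (ℳ : ℤ → Submodule k M) : EReal :=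
  ⨆ (i : ℕ) (n : ℤ) (_ : Nontrivial (localCoh r ℳ i n)), (((n + i : ℤ) : ℝ) : EReal)

end Module

/-- The depth of `M`: the supremum of the lengths of the `M`-regular sequences in `𝔪`. -/
def depth (k : Type u) [Field k] (r : ℕ) (M : Type v) [AddCommGroup M]
    [Module (MvPolynomial (Fin r) k) M] : ℕ∞ :=
  ⨆ (s : List (MvPolynomial (Fin r) k)) (_ : ∀ f ∈ s, f ∈ maxIdeal k r)
    (_ : RingTheory.Sequence.IsRegular M s), (s.length : ℕ∞)

/-! ### Standard graded algebras -/

/-- The ideals `I` for which `k[x₁, …, x_r] / I` is a standard graded `k`-algebra: the proper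
homogeneous ones. -/
def IsStdGraded (I : Ideal (MvPolynomial (Fin r) k)) : Prop :=
  (∀ f ∈ I, ∀ n : ℕ, homogeneousComponent n f ∈ I) ∧ I ≠ ⊤

/-- The grading of `R = k[x₁, …, x_r] / I` induced by the standard grading of the polynomial ring:
`R_n` is the image of the forms of degree `n` for `n ≥ 0`, and `R_n = 0` for `n < 0`. -/
def quotGrading (I : Ideal (MvPolynomial (Fin r) k)) :
    ℤ → Submodule k (MvPolynomial (Fin r) k ⧸ I)
  | .ofNat n => (homogeneousSubmodule (Fin r) k n).map (Ideal.Quotient.mkₐ k I).toLinearMap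
  | .negSucc _ => ⊥

/-- The saturation `J^{sat} = ⋃ₙ (J : 𝔪ⁿ)` of an ideal of the polynomial ring. -/
def saturation (J : Ideal (MvPolynomial (Fin r) k)) : Ideal (MvPolynomial (Fin r) k) where
  carrier := {f | ∃ n : ℕ, ∀ g ∈ maxIdeal k r ^ n, g * f ∈ J}
  zero_mem' := ⟨0, fun g _ => by simp⟩
  add_mem' := by
    rintro a b ⟨m, hm⟩ ⟨n, hn⟩
    refine ⟨m + n, fun g hg => ?_⟩
    rw [mul_add]
    exact J.add_mem (hm g (Ideal.pow_le_pow_right (Nat.le_add_right m n) hg))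
      (hn g (Ideal.pow_le_pow_right (Nat.le_add_left n m) hg))
  smul_mem' := by
    rintro c f ⟨n, hn⟩
    refine ⟨n, fun g hg => ?_⟩
    rw [smul_eq_mul, mul_left_comm]
    exact J.mul_mem_left c (hn g hg)

/-! ### The bounding polynomials -/

/-- The polynomial `binom(Y + q, q) = (Y + q)(Y + q - 1)⋯(Y + 1) / q!` for a polynomial `Y`. -/
def binomPoly (Y : Polynomial ℚ) (q : ℕ) : Polynomial ℚ :=
  Polynomial.C ((q.factorial : ℚ)⁻¹) * (descPochhammer ℚ q).comp (Y + (q : Polynomial ℚ))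

/-- `F_1 = X` and `F_p = F_{p-1} + X * binom(F_{p-1} + p - 1, p - 1)` for `p ≥ 2`.  The value at
`p = 0` is a placeholder. -/
def F : ℕ → Polynomial ℚ
  | 0 => 0
  | 1 => Polynomial.X
  | p + 2 => F (p + 1) + Polynomial.X * binomPoly (F (p + 1)) (p + 1)

end

end StdGraded

/-!
Write `S = k[x₁, …, x_r]`. The bound is obtained by Mumford's induction on the dimension. Three
quantities are controlled together for a saturated homogeneous ideal `I` (`IsBounded`): the
regularity of `S / I`, the dimensions of `H^1(S/I)_n` for `n ≥ 0`, and the degrees of the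
generators of `I`.

Let `x` be a regular linear form and `J` the saturation of `I + (x)`. In positive cohomological
degrees the Čech complexes of `(S/I)(-1)`, `S/I` and `S/J` form a short exact sequence, because
the torsion module `J / (I + (x))` disappears in every localization that inverts a variable
(`IsSection`). Together with the fact that Čech cohomology is torsion
(`exists_pow_smul_mem_coboundaries`), the long exact sequence gives the vanishing of the cohomology
of `S / I` in positions at least two, and
`dim H^1(S/I)_n ≤ dim H^1(S/I)_{n-1} + dim H^1(S/J)_n`. With `dim H^1(S/I)_0 ≤ t` this yields
`dim H^1(S/I)_n ≤ t * binom(n + d - 1, d - 1)` by induction on the dimension `d`. Finally, beyond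
the regularity `m` of `S / J` the dimension of `H^1(S/I)_n` drops strictly until it is zero, so
`H^1(S/I)_n` vanishes for `n ≥ m + dim H^1(S/I)_m` (`IsSection.isBounded`). This is the recursion
that defines `F_d`.

The induction starts in dimension one. There `dim H^1(S/I)_n` is the difference between the final
value of the Hilbert function of `S / I` and its value at `n` (`finrank_localCoh_one`), and the
Hilbert function grows strictly until it attains its final value. The field may be finite, so a
regular linear form need not exist; instead, the generic linear form `∑ x_j y^j` is used over
`S / I` extended to polynomials in `y`. It is regular by McCoy's theorem (`genericForm_regular`),
and dimensions are compared as ranks over `k[y]` (`hilb_eq_of_hilb_eq_succ`,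
`mem_genBy_of_hilb_eq`). A regular form of some positive degree does exist, by prime avoidance
(`exists_regular_form`).
-/

open MvPolynomial

namespace StdGraded

universe u v w

noncomputable section

variable {k : Type u} [Field k] {r : ℕ}

/-! ### Functoriality of the Čech complex -/

theorem exists_isHomogeneous_of_mem_monomials {σ : Finset (Fin r)}
    {p : MvPolynomial (Fin r) k} (hp : p ∈ monomials k σ) : ∃ e : ℕ, p.IsHomogeneous e := by
  induction hp using Submonoid.closure_induction with
  | mem x hx =>
    obtain ⟨i, -, rfl⟩ := hx
    exact ⟨1, isHomogeneous_X k i⟩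
  | one => exact ⟨0, isHomogeneous_one _ _⟩
  | mul x y _ _ hx hy =>
    obtain ⟨a, ha⟩ := hx
    obtain ⟨b, hb⟩ := hy
    exact ⟨a + b, ha.mul hb⟩

theorem ne_zero_of_mem_monomials {σ : Finset (Fin r)}
    {p : MvPolynomial (Fin r) k} (hp : p ∈ monomials k σ) : p ≠ 0 := by
  induction hp using Submonoid.closure_induction with
  | mem x hx =>
    obtain ⟨i, -, rfl⟩ := hx
    exact X_ne_zero i
  | one => exact one_ne_zero
  | mul x y _ _ hx hy => exact mul_ne_zero hx hy

theorem X_mem_monomials {σ : Finset (Fin r)} {j : Fin r} (hj : j ∈ σ) :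
    (X j : MvPolynomial (Fin r) k) ∈ monomials k σ :=
  Submonoid.subset_closure ⟨j, hj, rfl⟩

theorem exists_eq_mul_X_pow_of_mem_monomials {σ τ : Finset (Fin r)} {j : Fin r}
    (hτ : τ ⊆ insert j σ) {p : MvPolynomial (Fin r) k} (hp : p ∈ monomials k τ) :
    ∃ q ∈ monomials k σ, ∃ a : ℕ, p = q * X j ^ a := by
  have h : p ∈ monomials k (insert j σ) := monomials_mono hτ hp
  clear hp
  induction h using Submonoid.closure_induction with
  | mem x hx =>
    obtain ⟨i, hi, rfl⟩ := hx
    rcases Finset.mem_insert.1 (Finset.mem_coe.1 hi) with rfl | hi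
    · exact ⟨1, one_mem _, 1, by simp⟩
    · exact ⟨X i, X_mem_monomials hi, 0, by simp⟩
  | one => exact ⟨1, one_mem _, 0, by simp⟩
  | mul x y _ _ hx hy =>
    obtain ⟨q, hq, a, rfl⟩ := hx
    obtain ⟨q', hq', b, rfl⟩ := hy
    exact ⟨q * q', mul_mem hq hq', a + b, by ring⟩

section Module

variable {M : Type v} [AddCommGroup M] [Module (MvPolynomial (Fin r) k) M]
variable {N : Type w} [AddCommGroup N] [Module (MvPolynomial (Fin r) k) N]

/-- The map `M_{x_σ} → N_{x_σ}` induced by a linear map `M → N`. -/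
def locMap (σ : Finset (Fin r)) (f : M →ₗ[MvPolynomial (Fin r) k] N) :
    LocalizedModule (monomials k σ) M →ₗ[MvPolynomial (Fin r) k]
      LocalizedModule (monomials k σ) N :=
  IsLocalizedModule.map (monomials k σ) (LocalizedModule.mkLinearMap (monomials k σ) M)
    (LocalizedModule.mkLinearMap (monomials k σ) N) f

@[simp]
theorem locMap_mk (σ : Finset (Fin r)) (f : M →ₗ[MvPolynomial (Fin r) k] N) (m : M)
    (u : monomials k σ) : locMap σ f (LocalizedModule.mk m u) = LocalizedModule.mk (f m) u :=
  IsLocalizedModule.map_LocalizedModules _ _ _ _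

/-- The restriction `M_{x_σ} → M_{x_τ}` for `σ ⊆ τ`. -/
def res {σ τ : Finset (Fin r)} (h : σ ⊆ τ) :
    LocalizedModule (monomials k σ) M →ₗ[MvPolynomial (Fin r) k]
      LocalizedModule (monomials k τ) M :=
  LocalizedModule.liftOfLE (M := M) _ _ (monomials_mono (k := k) h)

@[simp]
theorem res_mk {σ τ : Finset (Fin r)} (h : σ ⊆ τ) (m : M) (u : monomials k σ) :
    res h (LocalizedModule.mk m u) = LocalizedModule.mk m ⟨u.1, monomials_mono h u.2⟩ := by
  rw [IsLocalizedModule.mk_eq_mk', IsLocalizedModule.mk_eq_mk']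
  exact IsLocalizedModule.liftOfLE_mk' _ _ _ _ _ _ _

theorem res_res {σ τ ρ : Finset (Fin r)} (h : σ ⊆ τ) (h' : τ ⊆ ρ)
    (z : LocalizedModule (monomials k σ) M) : res h' (res h z) = res (h.trans h') z := by
  induction z using LocalizedModule.induction_on with
  | h m u => simp

theorem locMap_res {σ τ : Finset (Fin r)} (h : σ ⊆ τ) (f : M →ₗ[MvPolynomial (Fin r) k] N)
    (z : LocalizedModule (monomials k σ) M) : locMap τ f (res h z) = res h (locMap σ f z) := by
  induction z using LocalizedModule.induction_on with
  | h m u => simp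

/-- The sign `(-1)^{#{j ∈ τ | j < i}}` of the Čech differential. -/
def sgn (k : Type u) [Field k] {r : ℕ} (τ : Finset (Fin r)) (i : Fin r) :
    MvPolynomial (Fin r) k := (-1) ^ (τ.filter (· < i)).card

theorem sgn_mul_self (τ : Finset (Fin r)) (i : Fin r) : sgn k τ i * sgn k τ i = 1 := by
  rw [sgn, ← pow_add, ← two_mul, pow_mul]; simp

theorem sgn_mul_sgn_erase_of_lt {τ : Finset (Fin r)} {i j : Fin r} (hi : i ∈ τ)
    (hij : i < j) : sgn k τ i * sgn k (τ.erase i) j = - (sgn k τ j * sgn k (τ.erase j) i) := by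
  have h1 : (τ.erase j).filter (· < i) = τ.filter (· < i) := by
    ext a; simp only [Finset.mem_filter, Finset.mem_erase]; grind
  have h2 : ((τ.erase i).filter (· < j)).card + 1 = (τ.filter (· < j)).card := by
    have : (τ.erase i).filter (· < j) = (τ.filter (· < j)).erase i := by
      ext a; simp only [Finset.mem_filter, Finset.mem_erase]; grind
    rw [this]
    exact Finset.card_erase_add_one (by simp [hi, hij])
  simp only [sgn]
  rw [h1, ← h2, pow_succ]
  ring

theorem sgn_mul_sgn_erase {τ : Finset (Fin r)} {i j : Fin r} (hi : i ∈ τ) (hj : j ∈ τ)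
    (hij : i ≠ j) : sgn k τ i * sgn k (τ.erase i) j = - (sgn k τ j * sgn k (τ.erase j) i) := by
  rcases lt_or_gt_of_ne hij with h | h
  · exact sgn_mul_sgn_erase_of_lt hi h
  · rw [sgn_mul_sgn_erase_of_lt hj h, neg_neg]

theorem cechD_apply {p : ℕ} (c : Cech (k := k) (r := r) M p)
    (τ : {s : Finset (Fin r) // s.card = p + 1}) :
    cechD M p c τ = ∑ i : {i // i ∈ τ.1}, sgn k τ.1 i.1 • res (Finset.erase_subset i.1 τ.1)
      (c ⟨τ.1.erase i.1, by rw [Finset.card_erase_of_mem i.2, τ.2]; rfl⟩) := by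
  simp only [cechD, LinearMap.pi_apply, LinearMap.sum_apply]
  refine Finset.sum_congr rfl fun i _ => ?_
  -- the integer sign of the differential and its image in the polynomial ring act equally
  rcases neg_one_pow_eq_or ℤ (τ.1.filter (· < i.1)).card with h | h
  · have h' : sgn k τ.1 i.1 = 1 := by
      simpa [sgn] using congrArg (Int.cast : ℤ → MvPolynomial (Fin r) k) h
    rw [h, h', one_smul, one_smul]
    rfl
  · have h' : sgn k τ.1 i.1 = -1 := by
      simpa [sgn] using congrArg (Int.cast : ℤ → MvPolynomial (Fin r) k) h
    rw [h, h', neg_one_smul, neg_one_smul]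
    rfl

/-- The restriction of the component `c_σ` of a Čech cochain to `M_{x_τ}`, extended by zero to
those `σ` which do not index a component or are not contained in `τ`. -/
def resComp {p : ℕ} (c : Cech (k := k) (r := r) M p) (τ σ : Finset (Fin r)) :
    LocalizedModule (monomials k τ) M :=
  if h : σ.card = p ∧ σ ⊆ τ then res h.2 (c ⟨σ, h.1⟩) else 0

theorem resComp_eq {p : ℕ} (c : Cech (k := k) (r := r) M p) {τ σ : Finset (Fin r)}
    (h : σ.card = p) (h' : σ ⊆ τ) : resComp c τ σ = res h' (c ⟨σ, h⟩) := by
  rw [resComp, dif_pos ⟨h, h'⟩]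

theorem cechD_apply_eq_sum {p : ℕ} (c : Cech (k := k) (r := r) M p)
    (τ : {s : Finset (Fin r) // s.card = p + 1}) :
    cechD M p c τ = ∑ i ∈ τ.1, sgn k τ.1 i • resComp c τ.1 (τ.1.erase i) := by
  rw [cechD_apply, ← Finset.sum_coe_sort τ.1]
  refine Finset.sum_congr rfl fun i _ => ?_
  rw [resComp_eq c (by rw [Finset.card_erase_of_mem i.2, τ.2]; rfl) (Finset.erase_subset _ _)]

theorem res_resComp {p : ℕ} (c : Cech (k := k) (r := r) M p) {τ ρ σ : Finset (Fin r)}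
    (h : σ.card = p) (h' : σ ⊆ τ) (hρ : τ ⊆ ρ) :
    res hρ (resComp c τ σ) = resComp c ρ σ := by
  rw [resComp_eq c h h', resComp_eq c h (h'.trans hρ), res_res]

theorem res_cechD_apply {p : ℕ} (c : Cech (k := k) (r := r) M p)
    {τ ρ : Finset (Fin r)} (h : τ.card = p + 1) (hρ : τ ⊆ ρ) :
    res hρ (cechD M p c ⟨τ, h⟩) = ∑ i ∈ τ, sgn k τ i • resComp c ρ (τ.erase i) := by
  rw [cechD_apply_eq_sum, map_sum]
  refine Finset.sum_congr rfl fun i hi => ?_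
  rw [map_smul, res_resComp c (by rw [Finset.card_erase_of_mem hi, h]; rfl)
    (Finset.erase_subset _ _)]

theorem cechD_cechD {p : ℕ} (c : Cech (k := k) (r := r) M p) :
    cechD M (p + 1) (cechD M p c) = 0 := by
  ext τ
  rw [cechD_apply_eq_sum]
  have h1 : ∀ i ∈ τ.1, sgn k τ.1 i • resComp (cechD M p c) τ.1 (τ.1.erase i) =
      ∑ j ∈ τ.1.erase i, (sgn k τ.1 i * sgn k (τ.1.erase i) j) •
        resComp c τ.1 ((τ.1.erase i).erase j) := by
    intro i hi
    rw [resComp_eq _ (by rw [Finset.card_erase_of_mem hi, τ.2]; rfl) (Finset.erase_subset _ _),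
      res_cechD_apply, Finset.smul_sum]
    simp only [mul_smul]
  rw [Finset.sum_congr rfl h1, Finset.sum_sigma']
  refine Finset.sum_involution (fun x _ => ⟨x.2, x.1⟩) ?_ ?_ ?_ ?_
  · rintro ⟨i, j⟩ h
    simp only [Finset.mem_sigma, Finset.mem_erase] at h
    rw [sgn_mul_sgn_erase h.1 h.2.2 (Ne.symm h.2.1), Finset.erase_right_comm]
    simp
  · rintro ⟨i, j⟩ h _
    simp only [Finset.mem_sigma, Finset.mem_erase] at h
    grind
  · rintro ⟨i, j⟩ h
    simp only [Finset.mem_sigma, Finset.mem_erase] at h ⊢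
    grind
  · rintro ⟨i, j⟩ h
    rfl

/-- The map of Čech complexes induced by a linear map `M → N`. -/
def cechMap (f : M →ₗ[MvPolynomial (Fin r) k] N) (p : ℕ) :
    Cech (k := k) (r := r) M p →ₗ[MvPolynomial (Fin r) k] Cech (k := k) (r := r) N p :=
  LinearMap.pi fun σ => (locMap σ.1 f).comp (LinearMap.proj σ)

@[simp]
theorem cechMap_apply (f : M →ₗ[MvPolynomial (Fin r) k] N) (p : ℕ)
    (c : Cech (k := k) (r := r) M p) (σ : {s : Finset (Fin r) // s.card = p}) :
    cechMap f p c σ = locMap σ.1 f (c σ) := rfl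

theorem cechD_cechMap (f : M →ₗ[MvPolynomial (Fin r) k] N) (p : ℕ)
    (c : Cech (k := k) (r := r) M p) :
    cechD N p (cechMap f p c) = cechMap f (p + 1) (cechD M p c) := by
  ext τ
  simp only [cechD_apply, cechMap_apply, map_sum, map_smul, locMap_res]

theorem locMap_injective (σ : Finset (Fin r)) {f : M →ₗ[MvPolynomial (Fin r) k] N}
    (hf : Function.Injective f) : Function.Injective (locMap σ f) :=
  IsLocalizedModule.map_injective _ _ _ _ hf

theorem cechMap_injective {f : M →ₗ[MvPolynomial (Fin r) k] N} (hf : Function.Injective f)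
    (p : ℕ) : Function.Injective (cechMap f p) := fun c c' h => by
  ext σ
  exact locMap_injective σ.1 hf (congrFun h σ)

/-- The kernel of `M_{x_σ} → M_{x_σ x_j}` is torsion with respect to the powers of `x_j`. -/
theorem exists_X_pow_smul_eq_zero {σ : Finset (Fin r)} (j : Fin r)
    {z : LocalizedModule (monomials k σ) M} (hz : res (Finset.subset_insert j σ) z = 0) :
    ∃ a : ℕ, (X j ^ a : MvPolynomial (Fin r) k) • z = 0 := by
  induction z using LocalizedModule.induction_on with
  | h m u =>
    rw [res_mk, ← LocalizedModule.zero_mk 1, LocalizedModule.mk_eq] at hz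
    obtain ⟨v, hv⟩ := hz
    obtain ⟨q, hq, a, hva⟩ := exists_eq_mul_X_pow_of_mem_monomials (σ := σ) (j := j)
      (subset_refl _) v.2
    refine ⟨a, ?_⟩
    rw [LocalizedModule.smul'_mk, ← LocalizedModule.zero_mk 1, LocalizedModule.mk_eq]
    refine ⟨⟨q, hq⟩, ?_⟩
    have h : v • m = 0 := by simpa using hv
    replace h : v.1 • m = 0 := h
    simp only [Submonoid.mk_smul, one_smul, smul_zero, ← mul_smul, ← hva, h]

end Module

/-! ### Gradings of the Čech complex -/

section Graded

variable {M : Type v} [AddCommGroup M] [Module (MvPolynomial (Fin r) k) M]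
variable {N : Type w} [AddCommGroup N] [Module (MvPolynomial (Fin r) k) N]
variable [Module k M] [IsScalarTower k (MvPolynomial (Fin r) k) M]
variable [Module k N] [IsScalarTower k (MvPolynomial (Fin r) k) N]
variable {ℳ : ℤ → Submodule k M} {𝒩 : ℤ → Submodule k N}

/-- A family `ℳ` of subspaces of a `k[x₁, …, x_r]`-module is compatible with the standard grading
of the polynomial ring if forms of degree `e` carry `ℳ n` into `ℳ (n + e)`. -/
def IsGradedFamily (r : ℕ) [Module (MvPolynomial (Fin r) k) M] (ℳ : ℤ → Submodule k M) : Prop :=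
  ∀ (e : ℕ) (g : MvPolynomial (Fin r) k), g.IsHomogeneous e → ∀ (n : ℤ), ∀ m ∈ ℳ n,
    g • m ∈ ℳ (n + e)

theorem mk_mem_locDegree {σ : Finset (Fin r)} {n n' : ℤ} {e : ℕ} {u : monomials k σ}
    (hu : u.1.IsHomogeneous e) {m : M} (hm : m ∈ ℳ n') (h : n' = n + e) :
    LocalizedModule.mk m u ∈ locDegree ℳ σ n :=
  Submodule.subset_span ⟨e, u, m, hu, h ▸ hm, rfl⟩

theorem mem_locDegree (hℳ : IsGradedFamily r ℳ) {σ : Finset (Fin r)} {n : ℤ}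
    {z : LocalizedModule (monomials k σ) M} :
    z ∈ locDegree ℳ σ n ↔ ∃ (e : ℕ) (u : monomials k σ) (m : M),
      u.1.IsHomogeneous e ∧ m ∈ ℳ (n + e) ∧ z = LocalizedModule.mk m u := by
  refine ⟨fun h => ?_, fun h => Submodule.subset_span h⟩
  induction h using Submodule.span_induction with
  | mem z h => exact h
  | zero => exact ⟨0, 1, 0, isHomogeneous_one _ _, zero_mem _, (LocalizedModule.zero_mk _).symm⟩
  | add x y _ _ hx hy =>
    obtain ⟨e, u, m, hu, hm, rfl⟩ := hx
    obtain ⟨e', u', m', hu', hm', rfl⟩ := hy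
    refine ⟨e + e', u * u', u' • m + u • m', hu.mul hu', add_mem ?_ ?_,
      LocalizedModule.mk_add_mk⟩
    · have := hℳ _ _ hu' _ _ hm
      rwa [add_assoc, ← Nat.cast_add] at this
    · have := hℳ _ _ hu _ _ hm'
      rwa [add_assoc, ← Nat.cast_add, add_comm e' e] at this
  | smul c x _ hx =>
    obtain ⟨e, u, m, hu, hm, rfl⟩ := hx
    refine ⟨e, u, c • m, hu, Submodule.smul_mem _ _ hm, ?_⟩
    rw [← algebraMap_smul (MvPolynomial (Fin r) k) c, LocalizedModule.smul'_mk, algebraMap_smul]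

theorem res_mem_locDegree (hℳ : IsGradedFamily r ℳ) {σ τ : Finset (Fin r)} (h : σ ⊆ τ) {n : ℤ}
    {z : LocalizedModule (monomials k σ) M} (hz : z ∈ locDegree ℳ σ n) :
    res h z ∈ locDegree ℳ τ n := by
  obtain ⟨e, u, m, hu, hm, rfl⟩ := (mem_locDegree hℳ).1 hz
  rw [res_mk]
  exact mk_mem_locDegree (u := ⟨u.1, monomials_mono h u.2⟩) hu hm rfl

theorem smul_mem_locDegree (hℳ : IsGradedFamily r ℳ) {σ : Finset (Fin r)} {n : ℤ}
    {z : LocalizedModule (monomials k σ) M} (hz : z ∈ locDegree ℳ σ n) {e : ℕ}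
    {g : MvPolynomial (Fin r) k} (hg : g.IsHomogeneous e) :
    g • z ∈ locDegree ℳ σ (n + e) := by
  obtain ⟨a, u, m, hu, hm, rfl⟩ := (mem_locDegree hℳ).1 hz
  rw [LocalizedModule.smul'_mk]
  exact mk_mem_locDegree hu (hℳ e g hg _ _ hm) (by ring)

theorem locMap_mem_locDegree (hℳ : IsGradedFamily r ℳ) {σ : Finset (Fin r)} {n e : ℤ}
    {f : M →ₗ[MvPolynomial (Fin r) k] N} (hf : ∀ n, ∀ m ∈ ℳ n, f m ∈ 𝒩 (n + e))
    {z : LocalizedModule (monomials k σ) M} (hz : z ∈ locDegree ℳ σ n) :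
    locMap σ f z ∈ locDegree 𝒩 σ (n + e) := by
  obtain ⟨a, u, m, hu, hm, rfl⟩ := (mem_locDegree hℳ).1 hz
  rw [locMap_mk]
  exact mk_mem_locDegree hu (hf _ _ hm) (by ring)

theorem exists_locMap_eq (h𝒩 : IsGradedFamily r 𝒩) {σ : Finset (Fin r)} {n : ℤ}
    {f : M →ₗ[MvPolynomial (Fin r) k] N} (hf : ∀ n, ∀ y ∈ 𝒩 n, ∃ m ∈ ℳ n, f m = y)
    {z : LocalizedModule (monomials k σ) N} (hz : z ∈ locDegree 𝒩 σ n) :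
    ∃ w ∈ locDegree ℳ σ n, locMap σ f w = z := by
  obtain ⟨a, u, y, hu, hy, rfl⟩ := (mem_locDegree h𝒩).1 hz
  obtain ⟨m, hm, rfl⟩ := hf _ _ hy
  exact ⟨_, mk_mem_locDegree hu hm rfl, locMap_mk _ _ _ _⟩

theorem mem_cechDegree {p : ℕ} {n : ℤ} {c : Cech (k := k) (r := r) M p} :
    c ∈ cechDegree ℳ p n ↔ ∀ σ, c σ ∈ locDegree ℳ σ.1 n := by
  simp [cechDegree, Submodule.mem_pi]

theorem mem_cocycles {p : ℕ} {n : ℤ} {c : Cech (k := k) (r := r) M p} :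
    c ∈ cocycles r ℳ p n ↔ c ∈ cechDegree ℳ p n ∧ cechD M p c = 0 := Iff.rfl

theorem mem_coboundaries {p : ℕ} {n : ℤ} {c : Cech (k := k) (r := r) M (p + 1)} :
    c ∈ coboundaries r ℳ (p + 1) n ↔ ∃ b ∈ cechDegree ℳ p n, cechD M p b = c := Iff.rfl

theorem cechD_mem_cechDegree (hℳ : IsGradedFamily r ℳ) {p : ℕ} {n : ℤ}
    {c : Cech (k := k) (r := r) M p} (hc : c ∈ cechDegree ℳ p n) :
    cechD M p c ∈ cechDegree ℳ (p + 1) n := by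
  rw [mem_cechDegree] at hc ⊢
  intro τ
  rw [cechD_apply]
  refine sum_mem fun i _ => ?_
  have h := res_mem_locDegree hℳ (Finset.erase_subset i.1 τ.1)
    (hc ⟨τ.1.erase i.1, by rw [Finset.card_erase_of_mem i.2, τ.2]; rfl⟩)
  rcases neg_one_pow_eq_or (MvPolynomial (Fin r) k) (τ.1.filter (· < i.1)).card with hs | hs
  · rwa [sgn, hs, one_smul]
  · rw [sgn, hs, neg_one_smul]
    exact neg_mem h

theorem coboundaries_le_cocycles (hℳ : IsGradedFamily r ℳ) (p : ℕ) (n : ℤ) :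
    coboundaries r ℳ p n ≤ cocycles r ℳ p n := by
  cases p with
  | zero => exact bot_le
  | succ p =>
    rintro _ ⟨b, hb, rfl⟩
    exact ⟨cechD_mem_cechDegree hℳ hb, cechD_cechD b⟩

theorem smul_mem_cechDegree (hℳ : IsGradedFamily r ℳ) {p : ℕ} {n : ℤ}
    {c : Cech (k := k) (r := r) M p} (hc : c ∈ cechDegree ℳ p n) {e : ℕ}
    {g : MvPolynomial (Fin r) k} (hg : g.IsHomogeneous e) :
    g • c ∈ cechDegree ℳ p (n + e) :=
  mem_cechDegree.2 fun σ => smul_mem_locDegree hℳ (mem_cechDegree.1 hc σ) hg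

theorem smul_mem_coboundaries (hℳ : IsGradedFamily r ℳ) {p : ℕ} {n : ℤ}
    {c : Cech (k := k) (r := r) M p} (hc : c ∈ coboundaries r ℳ p n) {e : ℕ}
    {g : MvPolynomial (Fin r) k} (hg : g.IsHomogeneous e) :
    g • c ∈ coboundaries r ℳ p (n + e) := by
  cases p with
  | zero =>
    have : c = 0 := hc
    rw [this, smul_zero]
    exact zero_mem _
  | succ p =>
    obtain ⟨b, hb, rfl⟩ := mem_coboundaries.1 hc
    exact mem_coboundaries.2 ⟨g • b, smul_mem_cechDegree hℳ hb hg, map_smul _ _ _⟩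

theorem cechMap_mem_cechDegree (hℳ : IsGradedFamily r ℳ) {p : ℕ} {n e : ℤ}
    {f : M →ₗ[MvPolynomial (Fin r) k] N} (hf : ∀ n, ∀ m ∈ ℳ n, f m ∈ 𝒩 (n + e))
    {c : Cech (k := k) (r := r) M p} (hc : c ∈ cechDegree ℳ p n) :
    cechMap f p c ∈ cechDegree 𝒩 p (n + e) :=
  mem_cechDegree.2 fun σ => locMap_mem_locDegree hℳ hf (mem_cechDegree.1 hc σ)

theorem exists_cechMap_eq (h𝒩 : IsGradedFamily r 𝒩) {p : ℕ} {n : ℤ}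
    {f : M →ₗ[MvPolynomial (Fin r) k] N} (hf : ∀ n, ∀ y ∈ 𝒩 n, ∃ m ∈ ℳ n, f m = y)
    {c : Cech (k := k) (r := r) N p} (hc : c ∈ cechDegree 𝒩 p n) :
    ∃ b ∈ cechDegree ℳ p n, cechMap f p b = c := by
  choose b hb hb' using fun σ => exists_locMap_eq (ℳ := ℳ) h𝒩 hf (mem_cechDegree.1 hc σ)
  exact ⟨b, mem_cechDegree.2 hb, funext hb'⟩

/-! ### Čech cohomology is torsion -/

/-- Every element of `M_{x_τ}` comes from `M_{x_σ}` after multiplication with a power of `x_j` if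
`τ` is contained in `σ ∪ {j}`. -/
theorem exists_res_eq_X_pow_smul (hℳ : IsGradedFamily r ℳ) {σ τ : Finset (Fin r)} {j : Fin r}
    (hστ : σ ⊆ τ) (hτ : τ ⊆ insert j σ) {n : ℤ} {z : LocalizedModule (monomials k τ) M}
    (hz : z ∈ locDegree ℳ τ n) :
    ∃ (a : ℕ), ∃ w ∈ locDegree ℳ σ (n + a),
      res hστ w = (X j ^ a : MvPolynomial (Fin r) k) • z := by
  obtain ⟨e, u, m, hu, hm, rfl⟩ := (mem_locDegree hℳ).1 hz
  obtain ⟨q, hq, a, hua⟩ := exists_eq_mul_X_pow_of_mem_monomials hτ u.2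
  obtain ⟨b, hb⟩ := exists_isHomogeneous_of_mem_monomials hq
  have hab : e = b + a := by
    refine hu.inj_right ?_ (ne_zero_of_mem_monomials u.2)
    rw [hua]
    exact hb.mul (isHomogeneous_X_pow j a)
  refine ⟨a, LocalizedModule.mk m ⟨q, hq⟩,
    mk_mem_locDegree hb hm (by rw [hab]; push_cast; ring), ?_⟩
  rw [res_mk, LocalizedModule.smul'_mk, LocalizedModule.mk_eq]
  refine ⟨1, ?_⟩
  simp only [one_smul, Submonoid.smul_def, ← mul_smul, hua]

/-- The contracting homotopy of the localization of the Čech complex at `x_j`, with denominators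
cleared: a cocycle of positive cohomological degree becomes a coboundary after multiplication with
a power of `x_j`. -/
theorem exists_X_pow_smul_mem_coboundaries (hℳ : IsGradedFamily r ℳ) {p : ℕ} {n : ℤ}
    {c : Cech (k := k) (r := r) M (p + 1)} (hc : c ∈ cocycles r ℳ (p + 1) n) (j : Fin r) :
    ∃ a : ℕ, (X j ^ a : MvPolynomial (Fin r) k) • c ∈ coboundaries r ℳ (p + 1) (n + a) := by
  obtain ⟨hc, hdc⟩ := mem_cocycles.1 hc
  rw [mem_cechDegree] at hc
  -- a common exponent with which all components whose index contains `j` extend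
  have key1 : ∃ a : ℕ, ∀ σ : {s : Finset (Fin r) // s.card = p}, ∃ w ∈ locDegree ℳ σ.1 (n + a),
      (j ∈ σ.1 → w = 0) ∧
      ∀ (τ : {s : Finset (Fin r) // s.card = p + 1}), j ∈ τ.1 → ∀ h : τ.1.erase j = σ.1,
        res (h ▸ Finset.erase_subset j τ.1) w =
          sgn k τ.1 j • (X j ^ a : MvPolynomial (Fin r) k) • c τ := by
    have h1 : ∀ σ : {s : Finset (Fin r) // s.card = p}, ∃ a : ℕ,
        ∃ w ∈ locDegree ℳ σ.1 (n + a), (j ∈ σ.1 → w = 0) ∧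
      ∀ (τ : {s : Finset (Fin r) // s.card = p + 1}), j ∈ τ.1 → ∀ h : τ.1.erase j = σ.1,
        res (h ▸ Finset.erase_subset j τ.1) w =
          sgn k τ.1 j • (X j ^ a : MvPolynomial (Fin r) k) • c τ := by
      intro σ
      by_cases hj : j ∈ σ.1
      · refine ⟨0, 0, zero_mem _, fun _ => rfl, fun τ _ h => ?_⟩
        exact absurd (h ▸ hj) (Finset.notMem_erase j τ.1)
      · obtain ⟨a, w, hw, hwa⟩ := exists_res_eq_X_pow_smul hℳ (Finset.subset_insert j σ.1)
          (subset_refl _) (hc ⟨insert j σ.1, by rw [Finset.card_insert_of_notMem hj, σ.2]⟩)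
        refine ⟨a, sgn k (insert j σ.1) j • w, ?_, fun h => absurd h hj, fun τ hτ h => ?_⟩
        · rcases neg_one_pow_eq_or (MvPolynomial (Fin r) k)
            ((insert j σ.1).filter (· < j)).card with hs | hs
          · rwa [sgn, hs, one_smul]
          · rw [sgn, hs, neg_one_smul]
            exact neg_mem hw
        · obtain ⟨τ, hτc⟩ := τ
          obtain rfl : insert j σ.1 = τ := by rw [← h, Finset.insert_erase hτ]
          rw [map_smul, hwa]
    choose a w hw hw0 hwa using h1
    refine ⟨Finset.univ.sup a, fun σ => ?_⟩
    obtain ⟨b, hb⟩ := Nat.exists_eq_add_of_le (Finset.le_sup (f := a) (Finset.mem_univ σ))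
    rw [hb]
    refine ⟨(X j ^ b : MvPolynomial (Fin r) k) • w σ, ?_, fun h => ?_, fun τ hτ h => ?_⟩
    · have := smul_mem_locDegree hℳ (hw σ) (isHomogeneous_X_pow j b)
      rwa [add_assoc, ← Nat.cast_add] at this
    · rw [hw0 σ h, smul_zero]
    · rw [map_smul, hwa σ τ hτ h, pow_add, smul_comm, mul_comm, mul_smul]
  obtain ⟨a, ha⟩ := key1
  choose b hb hb0 hbc using ha
  -- on the components whose index contains `j` only the `j`-th summand of the differential is not
  -- zero
  have key2 : ∀ τ : {s : Finset (Fin r) // s.card = p + 1}, j ∈ τ.1 →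
      cechD M p b τ = (X j ^ a : MvPolynomial (Fin r) k) • c τ := by
    intro τ hτ
    rw [cechD_apply_eq_sum, Finset.sum_eq_single j]
    · rw [resComp_eq b (by rw [Finset.card_erase_of_mem hτ, τ.2]; rfl) (Finset.erase_subset _ _),
        hbc ⟨τ.1.erase j, _⟩ τ hτ rfl, ← mul_smul, sgn_mul_self, one_smul]
    · intro i hi hij
      rw [resComp_eq b (by rw [Finset.card_erase_of_mem hi, τ.2]; rfl) (Finset.erase_subset _ _),
        hb0 _ (Finset.mem_erase.2 ⟨Ne.symm hij, hτ⟩), map_zero, smul_zero]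
    · exact fun h => absurd hτ h
  -- on the other components the cocycle condition gives equality after restriction to the locus
  -- where `x_j` is invertible
  have key3 : ∀ τ : {s : Finset (Fin r) // s.card = p + 1},
      res (Finset.subset_insert j τ.1) (cechD M p b τ - (X j ^ a : MvPolynomial (Fin r) k) • c τ)
        = 0 := by
    intro τ
    by_cases hj : j ∈ τ.1
    · rw [key2 τ hj, sub_self, map_zero]
    rw [map_sub, map_smul, sub_eq_zero, res_cechD_apply b τ.2]
    have hcard : (insert j τ.1).card = p + 2 := by rw [Finset.card_insert_of_notMem hj, τ.2]
    have hd := congrFun hdc ⟨insert j τ.1, hcard⟩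
    rw [cechD_apply_eq_sum, Finset.sum_insert hj, Pi.zero_apply] at hd
    have herase : (insert j τ.1).erase j = τ.1 := Finset.erase_insert hj
    have h2 : ∀ i ∈ τ.1, sgn k τ.1 i • resComp b (insert j τ.1) (τ.1.erase i) =
        -((sgn k (insert j τ.1) j * X j ^ a) • sgn k (insert j τ.1) i •
          resComp c (insert j τ.1) ((insert j τ.1).erase i)) := by
      intro i hi
      have hij : i ≠ j := fun h => hj (h ▸ hi)
      have hi' : i ∈ insert j τ.1 := Finset.mem_insert_of_mem hi
      have hc1 : ((insert j τ.1).erase i).card = p + 1 := by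
        rw [Finset.card_erase_of_mem hi', hcard]; rfl
      have hc2 : (τ.1.erase i).card = p := by rw [Finset.card_erase_of_mem hi, τ.2]; rfl
      have hjm : j ∈ (insert j τ.1).erase i :=
        Finset.mem_erase.2 ⟨Ne.symm hij, Finset.mem_insert_self _ _⟩
      have he : ((insert j τ.1).erase i).erase j = τ.1.erase i := by
        rw [Finset.erase_right_comm, herase]
      have hsub : τ.1.erase i ⊆ (insert j τ.1).erase i :=
        Finset.erase_subset_erase i (Finset.subset_insert j τ.1)
      have h3 := hbc ⟨τ.1.erase i, hc2⟩ ⟨(insert j τ.1).erase i, hc1⟩ hjm he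
      rw [← res_resComp b hc2 hsub (Finset.erase_subset i _), resComp_eq b hc2 hsub, h3,
        resComp_eq c hc1 (Finset.erase_subset i _), map_smul, map_smul, ← mul_smul, ← mul_smul,
        ← mul_smul, ← neg_smul]
      congr 1
      have hs := sgn_mul_sgn_erase (k := k) hi' (Finset.mem_insert_self j τ.1) hij
      rw [herase] at hs
      linear_combination (X j ^ a * sgn k τ.1 i * sgn k (insert j τ.1) i) * hs -
        (X j ^ a * sgn k τ.1 i * sgn k ((insert j τ.1).erase i) j) *
          sgn_mul_self (k := k) (insert j τ.1) i -
        (X j ^ a * sgn k (insert j τ.1) i * sgn k (insert j τ.1) j) * sgn_mul_self (k := k) τ.1 i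
    rw [Finset.sum_congr rfl h2, Finset.sum_neg_distrib, ← Finset.smul_sum,
      eq_neg_of_add_eq_zero_right hd, smul_neg, neg_neg, herase,
      resComp_eq c τ.2 (Finset.subset_insert j τ.1), ← mul_smul]
    congr 1
    linear_combination X j ^ a * sgn_mul_self (k := k) (insert j τ.1) j
  choose a' ha' using fun τ => exists_X_pow_smul_eq_zero j (key3 τ)
  refine ⟨a + Finset.univ.sup a', mem_coboundaries.2
    ⟨(X j ^ Finset.univ.sup a' : MvPolynomial (Fin r) k) • b, ?_, ?_⟩⟩
  · have := smul_mem_cechDegree hℳ (mem_cechDegree.2 hb)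
      (isHomogeneous_X_pow j (Finset.univ.sup a'))
    rwa [add_assoc, ← Nat.cast_add] at this
  · ext τ
    obtain ⟨b', hb'⟩ := Nat.exists_eq_add_of_le (Finset.le_sup (f := a') (Finset.mem_univ τ))
    have h := congrArg (fun z => (X j ^ b' : MvPolynomial (Fin r) k) • z) (ha' τ)
    simp only [smul_zero] at h
    rw [← mul_smul, ← pow_add, add_comm b', ← hb', smul_sub, sub_eq_zero, ← mul_smul,
      ← pow_add, add_comm _ a] at h
    rw [map_smul]
    exact h

/-- Cocycles of positive cohomological degree become coboundaries after multiplication with a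
suitable power of a given form of positive degree. -/
theorem exists_pow_smul_mem_coboundaries (hℳ : IsGradedFamily r ℳ) {p : ℕ} {n : ℤ}
    {c : Cech (k := k) (r := r) M (p + 1)} (hc : c ∈ cocycles r ℳ (p + 1) n) {e : ℕ}
    (he : 0 < e) {x : MvPolynomial (Fin r) k} (hx : x.IsHomogeneous e) :
    ∃ a : ℕ, x ^ a • c ∈ coboundaries r ℳ (p + 1) (n + (e * a : ℕ)) := by
  choose a ha using exists_X_pow_smul_mem_coboundaries hℳ hc
  refine ⟨∑ j, a j + 1, ?_⟩
  rw [(x ^ (∑ j, a j + 1)).as_sum, Finset.sum_smul]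
  refine sum_mem fun s hs => ?_
  have hdeg : s.degree = e * (∑ j, a j + 1) := by
    have h := hx.pow (∑ j, a j + 1) (mem_support_iff.1 hs)
    rw [Finsupp.degree_eq_weight_one]
    exact h
  -- pigeonhole: the monomial is divisible by some `x_j ^ a j`
  obtain ⟨j, hj⟩ : ∃ j, a j ≤ s j := by
    by_contra! hlt
    have h1 : s.degree ≤ ∑ j, a j := by
      rw [Finsupp.degree_eq_sum]
      exact Finset.sum_le_sum fun j _ => (hlt j).le
    rw [hdeg] at h1
    nlinarith
  have hs' : s = (s - Finsupp.single j (a j)) + Finsupp.single j (a j) :=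
    (tsub_add_cancel_of_le (Finsupp.single_le_iff.2 hj)).symm
  set s₀ := s - Finsupp.single j (a j) with hs₀
  have hm : monomial s (coeff s (x ^ (∑ j, a j + 1))) =
      monomial s₀ (coeff s (x ^ (∑ j, a j + 1))) * X j ^ a j := by
    rw [X_pow_eq_monomial, monomial_mul, mul_one, ← hs']
  rw [hm, mul_smul]
  have h := smul_mem_coboundaries hℳ (ha j)
    (isHomogeneous_monomial (n := s₀.degree) (coeff s (x ^ (∑ j, a j + 1))) rfl)
  have hd : n + (a j : ℤ) + (s₀.degree : ℤ) = n + ((e * (∑ j, a j + 1) : ℕ) : ℤ) := by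
    have h1 := congrArg Finsupp.degree hs'
    rw [map_add, Finsupp.degree_single] at h1
    rw [← hdeg, h1]
    push_cast
    ring
  rwa [hd] at h

end Graded

/-! ### Forms and the grading of a quotient -/

section Quotient

attribute [local instance] MvPolynomial.gradedAlgebra

/-- The homogeneous polynomials of degree `n`, for an integer `n`. -/
def forms (k : Type u) [Field k] (r : ℕ) : ℤ → Submodule k (MvPolynomial (Fin r) k)
  | .ofNat n => homogeneousSubmodule (Fin r) k n
  | .negSucc _ => ⊥

theorem mem_forms_natCast {n : ℕ} {f : MvPolynomial (Fin r) k} :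
    f ∈ forms k r n ↔ f.IsHomogeneous n := Iff.rfl

theorem mul_mem_forms {e : ℕ} {g f : MvPolynomial (Fin r) k} (hg : g.IsHomogeneous e) {n : ℤ}
    (hf : f ∈ forms k r n) : g * f ∈ forms k r (n + e) := by
  cases n with
  | ofNat n =>
    have h : g * f ∈ forms k r ((e + n : ℕ) : ℤ) := hg.mul hf
    rwa [Nat.cast_add, add_comm] at h
  | negSucc n =>
    have : f = 0 := hf
    rw [this, mul_zero]
    exact zero_mem _

variable {I J : Ideal (MvPolynomial (Fin r) k)}

theorem mem_quotGrading {n : ℤ} {y : MvPolynomial (Fin r) k ⧸ I} :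
    y ∈ quotGrading I n ↔ ∃ f ∈ forms k r n, Ideal.Quotient.mk I f = y := by
  cases n with
  | ofNat n => exact Iff.rfl
  | negSucc n =>
    refine ⟨fun h => ⟨0, zero_mem _, ?_⟩, ?_⟩
    · rw [map_zero]
      exact h.symm
    · rintro ⟨f, hf, rfl⟩
      have : f = 0 := hf
      rw [this, map_zero]
      exact zero_mem _

theorem mk_mem_quotGrading {n : ℤ} {f : MvPolynomial (Fin r) k} (hf : f ∈ forms k r n) :
    Ideal.Quotient.mk I f ∈ quotGrading I n :=
  mem_quotGrading.2 ⟨f, hf, rfl⟩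

theorem smul_mk (g f : MvPolynomial (Fin r) k) :
    g • Ideal.Quotient.mk I f = Ideal.Quotient.mk I (g * f) := rfl

theorem isGradedFamily_quotGrading (I : Ideal (MvPolynomial (Fin r) k)) :
    IsGradedFamily r (quotGrading I) := by
  intro e g hg n m hm
  obtain ⟨f, hf, rfl⟩ := mem_quotGrading.1 hm
  exact mk_mem_quotGrading (mul_mem_forms hg hf)

/-- A form in `I + (x)` is the sum of a form of `I` and a multiple of `x` by a form. -/
theorem exists_form_of_mem_sup_span (hI : I.IsHomogeneous (homogeneousSubmodule (Fin r) k))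
    {x : MvPolynomial (Fin r) k} {e : ℕ} (hx : x.IsHomogeneous e) {n : ℤ}
    {f : MvPolynomial (Fin r) k} (hf : f ∈ forms k r n) (hfI : f ∈ I ⊔ Ideal.span {x}) :
    ∃ a ∈ I, ∃ s ∈ forms k r (n - e), a ∈ forms k r n ∧ f = a + x * s := by
  cases n with
  | negSucc n =>
    have : f = 0 := hf
    exact ⟨0, zero_mem _, 0, zero_mem _, zero_mem _, by simp [this]⟩
  | ofNat n =>
    obtain ⟨a, ha, b, hb, rfl⟩ := Submodule.mem_sup.1 hfI
    obtain ⟨s, rfl⟩ := Ideal.mem_span_singleton.1 hb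
    have hf' : (a + x * s).IsHomogeneous n := hf
    have h1 : a + x * s = homogeneousComponent n a + homogeneousComponent n (x * s) := by
      rw [← map_add, homogeneousComponent_eq_self hf']
    have ha' := homogeneousComponent_mem_of_mem hI ha n
    by_cases hen : e ≤ n
    · refine ⟨_, ha', homogeneousComponent (n - e) s, ?_,
        homogeneousComponent_isHomogeneous n a, ?_⟩
      · have : ((Int.ofNat n : ℤ) - e) = ((n - e : ℕ) : ℤ) := by simp [hen]
        rw [this]
        exact homogeneousComponent_isHomogeneous _ _
      · rw [h1]
        congr 1
        rw [← decomposition.decompose'_apply, ← decomposition.decompose'_apply]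
        exact DirectSum.coe_decompose_mul_of_left_mem_of_le
          (homogeneousSubmodule (Fin r) k) (b := s) hx hen
    · refine ⟨_, ha', 0, zero_mem _, homogeneousComponent_isHomogeneous n a, ?_⟩
      rw [h1]
      congr 1
      rw [mul_zero, ← decomposition.decompose'_apply]
      exact DirectSum.coe_decompose_mul_of_left_mem_of_not_le
        (homogeneousSubmodule (Fin r) k) (b := s) hx hen

/-- The projection `S / I → S / J` for ideals `I ≤ J`. -/
def quotProj (h : I ≤ J) :
    (MvPolynomial (Fin r) k ⧸ I) →ₗ[MvPolynomial (Fin r) k] (MvPolynomial (Fin r) k ⧸ J) :=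
  (Ideal.Quotient.factorₐ (MvPolynomial (Fin r) k) h).toLinearMap

theorem quotProj_mk (h : I ≤ J) (f : MvPolynomial (Fin r) k) :
    quotProj h (Ideal.Quotient.mk I f) = Ideal.Quotient.mk J f := rfl

/-- An ideal `I` is saturated if every `f` with `𝔪ⁿ f ⊆ I` for some `n` lies in `I`; the condition
is tested on the powers of the variables. -/
def IsSaturated (I : Ideal (MvPolynomial (Fin r) k)) : Prop :=
  ∀ f, (∀ j, ∃ a : ℕ, X j ^ a * f ∈ I) → f ∈ I

/-! ### Čech cohomology in degree zero -/

section CechZero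

variable {M : Type v} [AddCommGroup M] [Module (MvPolynomial (Fin r) k) M]
variable {N : Type w} [AddCommGroup N] [Module (MvPolynomial (Fin r) k) N]

/-- The identification of `M` with the term of the Čech complex in position `0`. -/
def toCechZero (k : Type u) [Field k] (r : ℕ) (M : Type v) [AddCommGroup M]
    [Module (MvPolynomial (Fin r) k) M] :
    M →ₗ[MvPolynomial (Fin r) k] Cech (k := k) (r := r) M 0 :=
  LinearMap.pi fun σ => LocalizedModule.mkLinearMap (monomials k σ.1) M

theorem toCechZero_apply (m : M) (σ : {s : Finset (Fin r) // s.card = 0}) :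
    toCechZero k r M m σ = LocalizedModule.mk m 1 := rfl

theorem cechMap_toCechZero (f : M →ₗ[MvPolynomial (Fin r) k] N) (m : M) :
    cechMap f 0 (toCechZero k r M m) = toCechZero k r N (f m) := by
  ext σ
  rw [cechMap_apply, toCechZero_apply, locMap_mk, toCechZero_apply]

theorem eq_one_of_mem_monomials_empty {p : MvPolynomial (Fin r) k} (hp : p ∈ monomials k ∅) :
    p = 1 := by
  simpa [monomials] using hp

theorem exists_X_pow_smul_eq_zero_of_cechD_toCechZero {m : M}
    (h : cechD M 0 (toCechZero k r M m) = 0) (j : Fin r) :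
    ∃ a : ℕ, (X j ^ a : MvPolynomial (Fin r) k) • m = 0 := by
  have h1 := congrFun h ⟨{j}, rfl⟩
  rw [cechD_apply_eq_sum, Finset.sum_singleton, resComp_eq _ (by simp) (Finset.erase_subset _ _),
    toCechZero_apply, res_mk, Pi.zero_apply] at h1
  have h2 := congrArg (fun z => sgn k {j} j • z) h1
  simp only [← mul_smul, sgn_mul_self, one_smul, smul_zero] at h2
  rw [← LocalizedModule.zero_mk 1, LocalizedModule.mk_eq] at h2
  obtain ⟨v, hv⟩ := h2
  obtain ⟨q, hq, a, hva⟩ := exists_eq_mul_X_pow_of_mem_monomials (σ := ∅) (j := j)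
    (by simp) v.2
  refine ⟨a, ?_⟩
  rw [eq_one_of_mem_monomials_empty hq, one_mul] at hva
  rw [← hva]
  have hv' : v.1 • (1 : monomials k ({j} : Finset (Fin r))).1 • m = 0 := by
    simpa [Submonoid.smul_def] using hv
  simpa using hv'

variable [Module k M] [IsScalarTower k (MvPolynomial (Fin r) k) M] {ℳ : ℤ → Submodule k M}

theorem toCechZero_mem_cechDegree {m : M} {n : ℤ} (hm : m ∈ ℳ n) :
    toCechZero k r M m ∈ cechDegree ℳ 0 n :=
  mem_cechDegree.2 fun σ => mk_mem_locDegree (u := 1) (e := 0) (isHomogeneous_one _ _) hm (by simp)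

theorem exists_toCechZero_eq (hℳ : IsGradedFamily r ℳ) {n : ℤ}
    {c : Cech (k := k) (r := r) M 0} (hc : c ∈ cechDegree ℳ 0 n) :
    ∃ m ∈ ℳ n, toCechZero k r M m = c := by
  obtain ⟨e, u, m, hu, hm, hc'⟩ := (mem_locDegree hℳ).1 (mem_cechDegree.1 hc ⟨∅, rfl⟩)
  have hu1 : u = 1 := Subtype.ext (eq_one_of_mem_monomials_empty u.2)
  subst hu1
  have he : e = 0 := hu.inj_right (isHomogeneous_one _ _) one_ne_zero
  refine ⟨m, by simpa [he] using hm, funext fun σ => ?_⟩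
  obtain ⟨σ, hσ⟩ := σ
  obtain rfl := Finset.card_eq_zero.1 hσ
  exact hc'.symm

end CechZero

theorem mem_of_cechD_toCechZero (hI : IsSaturated I) {f : MvPolynomial (Fin r) k}
    (h : cechD _ 0 (toCechZero k r _ (Ideal.Quotient.mk I f)) = 0) : f ∈ I := by
  refine hI f fun j => ?_
  obtain ⟨a, ha⟩ := exists_X_pow_smul_eq_zero_of_cechD_toCechZero h j
  exact ⟨a, Ideal.Quotient.eq_zero_iff_mem.1 ha⟩

theorem cocycles_zero_eq_bot (hI : IsSaturated I) (n : ℤ) :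
    cocycles r (quotGrading I) 0 n = ⊥ := by
  refine (Submodule.eq_bot_iff _).2 fun c hc => ?_
  obtain ⟨hc, hdc⟩ := mem_cocycles.1 hc
  obtain ⟨m, hm, rfl⟩ := exists_toCechZero_eq (isGradedFamily_quotGrading I) hc
  obtain ⟨f, rfl⟩ := Ideal.Quotient.mk_surjective m
  rw [Ideal.Quotient.eq_zero_iff_mem.2 (mem_of_cechD_toCechZero hI hdc), map_zero]

/-! ### The long exact sequence of a hyperplane section up to saturation -/

/-- `J` lies between `I + (x)` and its saturation, where `x` is a form of degree `e` which is
regular on `S / I`.  The sequence `0 → (S / I)(-e) → S / I → S / J → 0` is then exact except for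
torsion in the middle. -/
structure IsSection (I J : Ideal (MvPolynomial (Fin r) k)) (x : MvPolynomial (Fin r) k) (e : ℕ) :
    Prop where
  homogeneous : I.IsHomogeneous (homogeneousSubmodule (Fin r) k)
  form : x.IsHomogeneous e
  regular : ∀ s, x * s ∈ I → s ∈ I
  le : I ≤ J
  mem : x ∈ J
  torsion : ∀ f ∈ J, ∀ j, ∃ a : ℕ, X j ^ a * f ∈ I ⊔ Ideal.span {x}

theorem cechMap_lsmul {M : Type v} [AddCommGroup M] [Module (MvPolynomial (Fin r) k) M]
    (x : MvPolynomial (Fin r) k) (p : ℕ) (c : Cech (k := k) (r := r) M p) :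
    cechMap (LinearMap.lsmul (MvPolynomial (Fin r) k) M x) p c = x • c := by
  ext σ
  rw [cechMap_apply, Pi.smul_apply]
  induction c σ using LocalizedModule.induction_on with
  | h m u => rw [locMap_mk, LocalizedModule.smul'_mk, LinearMap.lsmul_apply]

namespace IsSection

variable {x : MvPolynomial (Fin r) k} {e : ℕ} (h : IsSection I J x e)

include h

theorem smul_injective (p : ℕ) {c c' : Cech (k := k) (r := r) (MvPolynomial (Fin r) k ⧸ I) p}
    (hc : x • c = x • c') : c = c' := by
  rw [← cechMap_lsmul, ← cechMap_lsmul] at hc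
  refine cechMap_injective ?_ p hc
  rw [injective_iff_map_eq_zero]
  intro m hm
  obtain ⟨f, rfl⟩ := Ideal.Quotient.mk_surjective m
  rw [LinearMap.lsmul_apply, smul_mk, Ideal.Quotient.eq_zero_iff_mem] at hm
  exact Ideal.Quotient.eq_zero_iff_mem.2 (h.regular f hm)

theorem cechMap_quotProj_mem {p : ℕ} {n : ℤ}
    {c : Cech (k := k) (r := r) (MvPolynomial (Fin r) k ⧸ I) p}
    (hc : c ∈ cechDegree (quotGrading I) p n) :
    cechMap (quotProj h.le) p c ∈ cechDegree (quotGrading J) p n := by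
  have := cechMap_mem_cechDegree (𝒩 := quotGrading J) (e := 0) (f := quotProj h.le)
    (isGradedFamily_quotGrading I) (fun n m hm => ?_) hc
  · rwa [add_zero] at this
  · obtain ⟨f, hf, rfl⟩ := mem_quotGrading.1 hm
    rw [add_zero]
    exact mk_mem_quotGrading hf

theorem cechMap_quotProj_smul {p : ℕ}
    (c : Cech (k := k) (r := r) (MvPolynomial (Fin r) k ⧸ I) p) :
    cechMap (quotProj h.le) p (x • c) = 0 := by
  rw [map_smul]
  ext σ
  rw [Pi.smul_apply]
  generalize cechMap (quotProj h.le) p c σ = z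
  induction z using LocalizedModule.induction_on with
  | h m u =>
    obtain ⟨f, rfl⟩ := Ideal.Quotient.mk_surjective m
    rw [LocalizedModule.smul'_mk, smul_mk,
      Ideal.Quotient.eq_zero_iff_mem.2 (J.mul_mem_right f h.mem), LocalizedModule.zero_mk]
    rfl

theorem exists_cechMap_quotProj_eq {p : ℕ} {n : ℤ}
    {c : Cech (k := k) (r := r) (MvPolynomial (Fin r) k ⧸ J) p}
    (hc : c ∈ cechDegree (quotGrading J) p n) :
    ∃ b ∈ cechDegree (quotGrading I) p n, cechMap (quotProj h.le) p b = c := by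
  refine exists_cechMap_eq (isGradedFamily_quotGrading J) (fun n y hy => ?_) hc
  obtain ⟨f, hf, rfl⟩ := mem_quotGrading.1 hy
  exact ⟨_, mk_mem_quotGrading hf, rfl⟩

theorem exists_smul_eq_of_locMap_eq_zero {σ : Finset (Fin r)} {j : Fin r} (hj : j ∈ σ) {n : ℤ}
    {z : LocalizedModule (monomials k σ) (MvPolynomial (Fin r) k ⧸ I)}
    (hz : z ∈ locDegree (quotGrading I) σ n) (hz0 : locMap σ (quotProj h.le) z = 0) :
    ∃ w ∈ locDegree (quotGrading I) σ (n - e), x • w = z := by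
  obtain ⟨b, u, m, hu, hm, rfl⟩ := (mem_locDegree (isGradedFamily_quotGrading I)).1 hz
  obtain ⟨f, hf, rfl⟩ := mem_quotGrading.1 hm
  rw [locMap_mk, quotProj_mk, ← LocalizedModule.zero_mk 1, LocalizedModule.mk_eq] at hz0
  obtain ⟨v, hv⟩ := hz0
  have hvf : v.1 * f ∈ J := by
    refine Ideal.Quotient.eq_zero_iff_mem.1 ?_
    rw [← smul_mk]
    simpa [Submonoid.smul_def] using hv
  obtain ⟨d, hd⟩ := exists_isHomogeneous_of_mem_monomials v.2
  obtain ⟨a, ha⟩ := h.torsion _ hvf j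
  obtain ⟨i, hi, s, hs, -, his⟩ := exists_form_of_mem_sup_span h.homogeneous h.form
    (mul_mem_forms (isHomogeneous_X_pow j a) (mul_mem_forms hd hf)) ha
  let q : monomials k σ := ⟨X j ^ a, pow_mem (X_mem_monomials hj) a⟩
  have hq : q.1.IsHomogeneous a := isHomogeneous_X_pow j a
  refine ⟨LocalizedModule.mk (Ideal.Quotient.mk I s) (q * v * u),
    mk_mem_locDegree (e := a + d + b) ((hq.mul hd).mul hu) (mk_mem_quotGrading hs)
      (by push_cast; ring), ?_⟩
  rw [LocalizedModule.smul'_mk, ← LocalizedModule.mk_cancel_common_left (q * v) u]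
  congr 1
  rw [Submonoid.smul_def, smul_mk, smul_mk, Submonoid.coe_mul, mul_assoc, his, map_add,
    Ideal.Quotient.eq_zero_iff_mem.2 hi, zero_add]

theorem exists_smul_eq_of_cechMap_eq_zero {p : ℕ} {n : ℤ}
    {c : Cech (k := k) (r := r) (MvPolynomial (Fin r) k ⧸ I) (p + 1)}
    (hc : c ∈ cechDegree (quotGrading I) (p + 1) n)
    (hc0 : cechMap (quotProj h.le) (p + 1) c = 0) :
    ∃ b ∈ cechDegree (quotGrading I) (p + 1) (n - e), x • b = c := by
  have h1 : ∀ σ : {s : Finset (Fin r) // s.card = p + 1},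
      ∃ w ∈ locDegree (quotGrading I) σ.1 (n - e), x • w = c σ := by
    intro σ
    obtain ⟨j, hj⟩ := Finset.card_pos.1 (by rw [σ.2]; exact Nat.succ_pos p)
    exact h.exists_smul_eq_of_locMap_eq_zero hj (mem_cechDegree.1 hc σ) (congrFun hc0 σ)
  choose b hb hb' using h1
  exact ⟨b, mem_cechDegree.2 hb, funext hb'⟩

/-- Exactness of `H^{p+1}(S/I)_{n-e} → H^{p+1}(S/I)_n → H^{p+1}(S/J)_n` in the middle. -/
theorem exists_cocycle_sub_mem {p : ℕ} {n : ℤ}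
    {c : Cech (k := k) (r := r) (MvPolynomial (Fin r) k ⧸ I) (p + 1)}
    (hc : c ∈ cocycles r (quotGrading I) (p + 1) n)
    (hcJ : cechMap (quotProj h.le) (p + 1) c ∈ coboundaries r (quotGrading J) (p + 1) n) :
    ∃ b ∈ cocycles r (quotGrading I) (p + 1) (n - e),
      c - x • b ∈ coboundaries r (quotGrading I) (p + 1) n := by
  obtain ⟨hc, hdc⟩ := mem_cocycles.1 hc
  obtain ⟨a, ha, hac⟩ := mem_coboundaries.1 hcJ
  obtain ⟨a', ha', rfl⟩ := h.exists_cechMap_quotProj_eq ha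
  have hG := isGradedFamily_quotGrading I
  obtain ⟨b, hb, hbc⟩ := h.exists_smul_eq_of_cechMap_eq_zero
    (sub_mem hc (cechD_mem_cechDegree hG ha')) (by rw [map_sub, ← cechD_cechMap, hac, sub_self])
  refine ⟨b, mem_cocycles.2 ⟨hb, h.smul_injective _ ?_⟩,
    mem_coboundaries.2 ⟨a', ha', by rw [hbc]; abel⟩⟩
  rw [← map_smul, hbc, map_sub, hdc, cechD_cechD, sub_zero, smul_zero]

/-- Exactness of `H^{p+1}(S/J)_n → H^{p+2}(S/I)_{n-e} → H^{p+2}(S/I)_n` in the middle, when the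
first term vanishes. -/
theorem mem_coboundaries_of_smul_mem {p : ℕ} {n : ℤ}
    (hJ : cocycles r (quotGrading J) (p + 1) n ≤ coboundaries r (quotGrading J) (p + 1) n)
    {c : Cech (k := k) (r := r) (MvPolynomial (Fin r) k ⧸ I) (p + 2)}
    (hxc : x • c ∈ coboundaries r (quotGrading I) (p + 2) n) :
    c ∈ coboundaries r (quotGrading I) (p + 2) (n - e) := by
  obtain ⟨b, hb, hbc⟩ := mem_coboundaries.1 hxc
  have hbJ : cechMap (quotProj h.le) (p + 1) b ∈ cocycles r (quotGrading J) (p + 1) n :=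
    mem_cocycles.2 ⟨h.cechMap_quotProj_mem hb,
      by rw [cechD_cechMap, hbc, h.cechMap_quotProj_smul]⟩
  obtain ⟨a, ha, hab⟩ := mem_coboundaries.1 (hJ hbJ)
  obtain ⟨a', ha', rfl⟩ := h.exists_cechMap_quotProj_eq ha
  have hG := isGradedFamily_quotGrading I
  obtain ⟨b', hb', hbb⟩ := h.exists_smul_eq_of_cechMap_eq_zero
    (sub_mem hb (cechD_mem_cechDegree hG ha')) (by rw [map_sub, ← cechD_cechMap, hab, sub_self])
  refine mem_coboundaries.2 ⟨b', hb', h.smul_injective _ ?_⟩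
  rw [← map_smul, hbb, map_sub, cechD_cechD, sub_zero, hbc]

/-- The connecting map sends the class in `(J / (I + (x)))_n` of a form to a class in
`H^1(S/I)_{n-e}` which `x` annihilates and which vanishes only if the given class does. -/
theorem exists_cocycle_smul_mem (hI : IsSaturated I) {n : ℤ} {f : MvPolynomial (Fin r) k}
    (hf : f ∈ forms k r n) (hfJ : f ∈ J) (hfI : f ∉ I ⊔ Ideal.span {x}) :
    ∃ c ∈ cocycles r (quotGrading I) 1 (n - e), c ∉ coboundaries r (quotGrading I) 1 (n - e) ∧
      x • c ∈ coboundaries r (quotGrading I) 1 n := by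
  have hG := isGradedFamily_quotGrading I
  have hb := toCechZero_mem_cechDegree (k := k) (r := r) (mk_mem_quotGrading (I := I) hf)
  obtain ⟨c, hc, hxc⟩ := h.exists_smul_eq_of_cechMap_eq_zero (cechD_mem_cechDegree hG hb) (by
    rw [← cechD_cechMap, cechMap_toCechZero, quotProj_mk, Ideal.Quotient.eq_zero_iff_mem.2 hfJ,
      map_zero, map_zero])
  refine ⟨c, mem_cocycles.2 ⟨hc, h.smul_injective _ ?_⟩, fun hcb => ?_,
    mem_coboundaries.2 ⟨_, hb, hxc.symm⟩⟩
  · rw [← map_smul, hxc, cechD_cechD, smul_zero]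
  · obtain ⟨a, ha, rfl⟩ := mem_coboundaries.1 hcb
    obtain ⟨m, hm, rfl⟩ := exists_toCechZero_eq hG ha
    obtain ⟨s, rfl⟩ := Ideal.Quotient.mk_surjective m
    have h1 : f - x * s ∈ I := by
      refine mem_of_cechD_toCechZero hI ?_
      rw [map_sub, ← smul_mk, map_sub, map_sub, ← hxc, map_smul, map_smul, sub_self]
    refine hfI ?_
    rw [← sub_add_cancel f (x * s)]
    exact add_mem (Ideal.mem_sup_left h1)
      (Ideal.mem_sup_right (Ideal.mem_span_singleton.2 (dvd_mul_right _ _)))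

/-- Multiplication by `x` is injective on `H^1(S/I)_{n-e}` if `J` and `I + (x)` have the same
forms of degree `n`. -/
theorem mem_coboundaries_one_of_smul_mem (hJ : IsSaturated J) {n : ℤ}
    (hJI : ∀ f ∈ forms k r n, f ∈ J → f ∈ I ⊔ Ideal.span {x})
    {c : Cech (k := k) (r := r) (MvPolynomial (Fin r) k ⧸ I) 1}
    (hxc : x • c ∈ coboundaries r (quotGrading I) 1 n) :
    c ∈ coboundaries r (quotGrading I) 1 (n - e) := by
  obtain ⟨b, hb, hbc⟩ := mem_coboundaries.1 hxc
  obtain ⟨m, hm, rfl⟩ := exists_toCechZero_eq (isGradedFamily_quotGrading I) hb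
  obtain ⟨f, hf, rfl⟩ := mem_quotGrading.1 hm
  have hfJ : f ∈ J := by
    refine mem_of_cechD_toCechZero hJ ?_
    rw [← quotProj_mk h.le, ← cechMap_toCechZero, cechD_cechMap, hbc, h.cechMap_quotProj_smul]
  obtain ⟨a, ha, s, hs, -, rfl⟩ := exists_form_of_mem_sup_span h.homogeneous h.form hf
    (hJI f hf hfJ)
  refine mem_coboundaries.2 ⟨_, toCechZero_mem_cechDegree (mk_mem_quotGrading hs),
    h.smul_injective _ ?_⟩
  rw [← hbc, map_add, Ideal.Quotient.eq_zero_iff_mem.2 ha, zero_add (Ideal.Quotient.mk I _),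
    ← smul_mk, map_smul, map_smul]

end IsSection

end Quotient

/-! ### Regular elements and saturated ideals -/

section Regular

variable {I : Ideal (MvPolynomial (Fin r) k)}

theorem exists_regular_of_depth_pos (h : 0 < depth k r (MvPolynomial (Fin r) k ⧸ I)) :
    ∃ g ∈ maxIdeal k r, IsSMulRegular (MvPolynomial (Fin r) k ⧸ I) g := by
  obtain ⟨s, hs⟩ := lt_iSup_iff.1 h
  obtain ⟨hsm, hs⟩ := lt_iSup_iff.1 hs
  obtain ⟨hreg, hs⟩ := lt_iSup_iff.1 hs
  cases s with
  | nil => simp at hs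
  | cons g l =>
    exact ⟨g, hsm g (by simp), ((RingTheory.Sequence.isRegular_cons_iff _ _ _).1 hreg).1⟩

theorem mem_of_mul_mem_of_isSMulRegular {g : MvPolynomial (Fin r) k}
    (hg : IsSMulRegular (MvPolynomial (Fin r) k ⧸ I) g) {f : MvPolynomial (Fin r) k}
    (hf : g * f ∈ I) : f ∈ I := by
  rw [← Ideal.Quotient.eq_zero_iff_mem] at hf ⊢
  exact hg (hf.trans (smul_zero g).symm)

/-- A power of `g` lies in every ideal that contains powers of all the variables. -/
theorem isSaturated_of_isSMulRegular {g : MvPolynomial (Fin r) k} (hgm : g ∈ maxIdeal k r)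
    (hg : IsSMulRegular (MvPolynomial (Fin r) k ⧸ I) g) : IsSaturated I := by
  intro f hf
  have h1 : maxIdeal k r ≤ (I.colon {f}).radical := by
    refine Ideal.span_le.2 ?_
    rintro _ ⟨j, rfl⟩
    obtain ⟨a, ha⟩ := hf j
    exact ⟨a, Submodule.mem_colon_singleton.2 ha⟩
  obtain ⟨a, ha⟩ := h1 hgm
  exact mem_of_mul_mem_of_isSMulRegular (hg.pow a) (Submodule.mem_colon_singleton.1 ha)

/-- Prime avoidance by forms of positive degree, over an arbitrary field: finitely many prime
ideals that do not contain the maximal graded ideal are avoided by such a form. -/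
theorem exists_form_notMem (T : Finset (Ideal (MvPolynomial (Fin r) k)))
    (hT : ∀ P ∈ T, P.IsPrime) (hTm : ∀ P ∈ T, ¬ maxIdeal k r ≤ P) :
    ∃ (e : ℕ) (f : MvPolynomial (Fin r) k), 0 < e ∧ f.IsHomogeneous e ∧ ∀ P ∈ T, f ∉ P := by
  classical
  induction hn : T.card generalizing T with
  | zero =>
    obtain rfl := Finset.card_eq_zero.1 hn
    exact ⟨1, 0, one_pos, isHomogeneous_zero _ _ _, by simp⟩
  | succ n ih =>
    by_cases hA : ∃ P ∈ T, ∃ Q ∈ T, P ≠ Q ∧ ∀ (e : ℕ) (f : MvPolynomial (Fin r) k),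
        f.IsHomogeneous e → f ∈ Q → f ∈ P
    · -- the forms of `Q` lie in `P`, hence `Q` may be omitted
      obtain ⟨P, hP, Q, hQ, hPQ, hfPQ⟩ := hA
      obtain ⟨e, f, he, hf, hfT⟩ := ih (T.erase Q) (fun P h => hT P (Finset.mem_of_mem_erase h))
        (fun P h => hTm P (Finset.mem_of_mem_erase h))
        (by rw [Finset.card_erase_of_mem hQ, hn]; rfl)
      refine ⟨e, f, he, hf, fun P' hP' hfP' => ?_⟩
      by_cases h : P' = Q
      · subst h
        exact hfT P (Finset.mem_erase.2 ⟨hPQ, hP⟩) (hfPQ e f hf hfP')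
      · exact hfT P' (Finset.mem_erase.2 ⟨h, hP'⟩) hfP'
    · push Not at hA
      obtain ⟨P, hP⟩ := Finset.card_pos.1 (by rw [hn]; exact Nat.succ_pos n)
      obtain ⟨e, f, he, hf, hfT⟩ := ih (T.erase P) (fun P h => hT P (Finset.mem_of_mem_erase h))
        (fun P h => hTm P (Finset.mem_of_mem_erase h))
        (by rw [Finset.card_erase_of_mem hP, hn]; rfl)
      by_cases hfP : f ∈ P
      swap
      · refine ⟨e, f, he, hf, fun P' hP' => ?_⟩
        by_cases h : P' = P
        · exact h ▸ hfP
        · exact hfT P' (Finset.mem_erase.2 ⟨h, hP'⟩)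
      have hPp := hT P hP
      have h1 : ∀ Q : Ideal (MvPolynomial (Fin r) k), ∃ (b : ℕ) (g : MvPolynomial (Fin r) k),
          g.IsHomogeneous b ∧ (Q ∈ T.erase P → g ∈ Q ∧ g ∉ P) := by
        intro Q
        by_cases hQ : Q ∈ T.erase P
        · obtain ⟨b, g, hg, hgQ, hgP⟩ := hA P hP Q (Finset.mem_of_mem_erase hQ)
            (Ne.symm (Finset.ne_of_mem_erase hQ))
          exact ⟨b, g, hg, fun _ => ⟨hgQ, hgP⟩⟩
        · exact ⟨0, 0, isHomogeneous_zero _ _ _, fun h => absurd h hQ⟩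
      choose b g hg hgQ using h1
      obtain ⟨j, hj⟩ : ∃ j : Fin r, (X j : MvPolynomial (Fin r) k) ∉ P := by
        by_contra! h
        refine hTm P hP (Ideal.span_le.2 ?_)
        rintro _ ⟨j, rfl⟩
        exact h j
      set G := X j * ∏ Q ∈ T.erase P, g Q with hG
      set B := 1 + ∑ Q ∈ T.erase P, b Q with hB
      have hGh : G.IsHomogeneous B :=
        (isHomogeneous_X k j).mul (IsHomogeneous.prod _ _ _ fun Q _ => hg Q)
      have hGP : G ∉ P := by
        refine hPp.mul_notMem hj fun h => ?_
        obtain ⟨Q, hQ, hQ'⟩ := hPp.prod_mem_iff.1 h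
        exact (hgQ Q hQ).2 hQ'
      -- `f` avoids all ideals but `P`, `G` lies in all ideals but `P`, and the powers serve to
      -- equalize the degrees
      have hB0 : B ≠ 0 := by omega
      refine ⟨e * B, f ^ B + G ^ e, by positivity, ?_, fun P' hP' hmem => ?_⟩
      · refine (hf.pow B).add ?_
        rw [mul_comm e B]
        exact hGh.pow e
      · by_cases h : P' = P
        · subst h
          rw [P'.add_mem_iff_right (P'.pow_mem_of_mem hfP B (Nat.pos_of_ne_zero hB0))] at hmem
          exact hGP (hPp.mem_of_pow_mem e hmem)
        · have hP'T := Finset.mem_erase.2 ⟨h, hP'⟩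
          have hGP' : G ∈ P' := P'.mul_mem_left _
            (P'.mem_of_dvd (Finset.dvd_prod_of_mem g hP'T) (hgQ P' hP'T).1)
          rw [P'.add_mem_iff_left (P'.pow_mem_of_mem hGP' e he)] at hmem
          exact hfT P' hP'T ((hT P' hP').mem_of_pow_mem B hmem)

/-- Positive depth is witnessed by a form, since the associated primes do not contain `𝔪`. Over a
finite field the form need not be linear. -/
theorem exists_regular_form {g : MvPolynomial (Fin r) k} (hgm : g ∈ maxIdeal k r)
    (hg : IsSMulRegular (MvPolynomial (Fin r) k ⧸ I) g) :
    ∃ (e : ℕ) (f : MvPolynomial (Fin r) k), 0 < e ∧ f.IsHomogeneous e ∧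
      IsSMulRegular (MvPolynomial (Fin r) k ⧸ I) f := by
  have hU := biUnion_associatedPrimes_eq_compl_regular (MvPolynomial (Fin r) k)
    (MvPolynomial (Fin r) k ⧸ I)
  have hfin := associatedPrimes.finite (MvPolynomial (Fin r) k) (MvPolynomial (Fin r) k ⧸ I)
  obtain ⟨e, f, he, hf, hfT⟩ := exists_form_notMem hfin.toFinset
    (fun P hP => (hfin.mem_toFinset.1 hP).isPrime) (fun P hP hm => by
      have : g ∈ {x : MvPolynomial (Fin r) k |
          IsSMulRegular (MvPolynomial (Fin r) k ⧸ I) x}ᶜ :=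
        hU ▸ Set.mem_biUnion (hfin.mem_toFinset.1 hP) (hm hgm)
      exact this hg)
  refine ⟨e, f, he, hf, ?_⟩
  by_contra hreg
  have : f ∈ ⋃ p ∈ associatedPrimes (MvPolynomial (Fin r) k) (MvPolynomial (Fin r) k ⧸ I),
      (p : Set (MvPolynomial (Fin r) k)) := by
    rw [hU]
    exact hreg
  obtain ⟨P, hP, hfP⟩ := Set.mem_iUnion₂.1 this
  exact hfT P (hfin.mem_toFinset.2 hP) hfP

end Regular

/-! ### Multiplication by a polynomial with coefficients in an algebra -/

section PolynomialCoefficients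

variable {R : Type v} [CommRing R] [Algebra k R]

/-- The polynomials over `R` with coefficients in a subspace `V` of `R`. -/
def polyOver (V : Submodule k R) : Submodule k (Polynomial R) where
  carrier := {s | ∀ m, s.coeff m ∈ V}
  zero_mem' m := by simp
  add_mem' hs ht m := by
    rw [Polynomial.coeff_add]
    exact add_mem (hs m) (ht m)
  smul_mem' c s hs m := by
    rw [Polynomial.coeff_smul]
    exact V.smul_mem c (hs m)

theorem map_mul_mem_polyOver {V : Submodule k R} {s : Polynomial R} (hs : s ∈ polyOver V)
    (c : Polynomial k) : c.map (algebraMap k R) * s ∈ polyOver V := by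
  intro m
  rw [Polynomial.coeff_mul]
  refine sum_mem fun i _ => ?_
  rw [Polynomial.coeff_map, ← Algebra.smul_def]
  exact V.smul_mem _ (hs _)

theorem C_mem_polyOver {V : Submodule k R} {w : R} (hw : w ∈ V) :
    Polynomial.C w ∈ polyOver V := by
  intro m
  rw [Polynomial.coeff_C]
  split_ifs
  · exact hw
  · exact zero_mem _

variable {ι : Type*} [Fintype ι] {ι' : Type*} [Fintype ι'] {V W : Submodule k R}

/-- The combination `∑ v_i b_i` of a family `b` of elements of `R` with coefficients `v_i` in
`k[y]`. -/
def polyComb (b : ι → R) (v : ι → Polynomial k) : Polynomial R :=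
  ∑ i, (v i).map (algebraMap k R) * Polynomial.C (b i)

theorem coeff_polyComb (b : ι → R) (v : ι → Polynomial k) (m : ℕ) :
    (polyComb b v).coeff m = ∑ i, (v i).coeff m • b i := by
  simp [polyComb, Polynomial.finsetSum_coeff, Polynomial.coeff_mul_C, Algebra.smul_def]

@[simp]
theorem polyComb_zero (b : ι → R) : polyComb b (0 : ι → Polynomial k) = 0 := by
  simp [polyComb]

theorem polyComb_injective (b : Module.Basis ι k V) :
    Function.Injective (polyComb (k := k) fun i => (b i : R)) := by
  intro v v' h
  ext i m
  have hm := congrArg (fun s => s.coeff m) h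
  simp only [coeff_polyComb] at hm
  have h1 : ∑ i, (v i).coeff m • b i = ∑ i, (v' i).coeff m • b i :=
    Subtype.ext (by simpa using hm)
  have h2 := congrArg (fun w => (b.repr w : ι → k)) h1
  simp only [b.repr_sum_self] at h2
  exact congrFun h2 i

theorem exists_polyComb_eq (b : Module.Basis ι k V) {s : Polynomial R} (hs : s ∈ polyOver V) :
    ∃ v : ι → Polynomial k, polyComb (fun i => (b i : R)) v = s := by
  refine ⟨fun i => ∑ m ∈ s.support, Polynomial.monomial m (b.repr ⟨s.coeff m, hs m⟩ i), ?_⟩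
  ext m
  have h1 : ∀ i, (∑ m' ∈ s.support, Polynomial.monomial m' (b.repr ⟨s.coeff m', hs m'⟩ i)).coeff m
      = b.repr ⟨s.coeff m, hs m⟩ i := by
    intro i
    rw [Polynomial.finsetSum_coeff]
    simp only [Polynomial.coeff_monomial]
    rw [Finset.sum_ite_eq']
    split_ifs with h
    · rfl
    · have h0 : (⟨s.coeff m, hs m⟩ : V) = 0 := Subtype.ext (Polynomial.notMem_support_iff.1 h)
      rw [h0]
      simp
  rw [coeff_polyComb]
  simp only [h1]
  have := congrArg (Subtype.val) (b.sum_repr ⟨s.coeff m, hs m⟩)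
  simpa only [Submodule.coe_sum, Submodule.coe_smul] using this

theorem polyComb_mem (b : Module.Basis ι k V) (v : ι → Polynomial k) :
    polyComb (fun i => (b i : R)) v ∈ polyOver V := by
  intro m
  rw [coeff_polyComb]
  exact sum_mem fun i _ => V.smul_mem _ (b i).2

/-- A matrix of the multiplication by `ξ` from `V[y]` to `W[y]`. -/
theorem polyComb_mulVec [DecidableEq ι] (b : Module.Basis ι k V) (b' : Module.Basis ι' k W)
    (A : Matrix ι' ι (Polynomial k)) {ξ : Polynomial R}
    (hA : ∀ i, polyComb (fun l => (b' l : R)) (fun l => A l i) = ξ * Polynomial.C (b i : R))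
    (v : ι → Polynomial k) :
    polyComb (fun l => (b' l : R)) (A.mulVec v) = ξ * polyComb (fun i => (b i : R)) v := by
  rw [polyComb, polyComb, Finset.mul_sum]
  have h1 : ∀ i, ξ * ((v i).map (algebraMap k R) * Polynomial.C (b i : R)) =
      ∑ l, (v i).map (algebraMap k R) *
        ((A l i).map (algebraMap k R) * Polynomial.C (b' l : R)) := by
    intro i
    rw [mul_left_comm, ← hA, polyComb, Finset.mul_sum]
  simp only [h1, Matrix.mulVec, dotProduct, Polynomial.map_sum, Polynomial.map_mul, Finset.sum_mul]
  rw [Finset.sum_comm]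
  refine Finset.sum_congr rfl fun i _ => Finset.sum_congr rfl fun l _ => ?_
  ring

variable [FiniteDimensional k V] [FiniteDimensional k W]

/-- If a nonzerodivisor `ξ` of `R[y]` carries `V[y]` into `W[y]`, then `dim V ≤ dim W`. -/
theorem finrank_le_of_mul_mem {ξ : Polynomial R} (hξ : ∀ s, ξ * s = 0 → s = 0)
    (hVW : ∀ s ∈ polyOver V, ξ * s ∈ polyOver W) :
    Module.finrank k V ≤ Module.finrank k W := by
  let b := Module.finBasis k V
  let b' := Module.finBasis k W
  choose A hA using fun i => exists_polyComb_eq b' (hVW _ (C_mem_polyOver (b i).2))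
  have h := polyComb_mulVec b b' (Matrix.of fun l i => A i l) hA
  refine le_of_fin_injective (Polynomial k) (Matrix.mulVecLin (Matrix.of fun l i => A i l)) ?_
  rw [injective_iff_map_eq_zero]
  intro v hv
  rw [Matrix.mulVecLin_apply] at hv
  refine polyComb_injective b ?_
  rw [polyComb_zero]
  refine hξ _ ?_
  rw [← h, hv, polyComb_zero]

/-- If in addition the dimensions agree, then `W[y] / ξ V[y]` is annihilated by a nonzero
polynomial, a determinant. -/
theorem exists_mul_eq_of_finrank_eq {ξ : Polynomial R} (hξ : ∀ s, ξ * s = 0 → s = 0)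
    (hVW : ∀ s ∈ polyOver V, ξ * s ∈ polyOver W)
    (hdim : Module.finrank k V = Module.finrank k W) :
    ∃ c : Polynomial k, c ≠ 0 ∧ ∀ w ∈ W, ∃ s ∈ polyOver V,
      c.map (algebraMap k R) * Polynomial.C w = ξ * s := by
  let b := Module.finBasis k V
  let b' := Module.finBasisOfFinrankEq k W hdim.symm
  choose A hA using fun i => exists_polyComb_eq b' (hVW _ (C_mem_polyOver (b i).2))
  have h := polyComb_mulVec b b' (Matrix.of fun l i => A i l) hA
  set B : Matrix (Fin (Module.finrank k V)) (Fin (Module.finrank k V)) (Polynomial k) :=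
    Matrix.of fun l i => A i l with hB
  refine ⟨B.det, fun hdet => ?_, fun w hw => ?_⟩
  · obtain ⟨v, hv0, hv⟩ := Matrix.exists_mulVec_eq_zero_iff.2 hdet
    refine hv0 (polyComb_injective b ?_)
    rw [polyComb_zero]
    refine hξ _ ?_
    rw [← h, hv, polyComb_zero]
  · obtain ⟨v, hv⟩ := exists_polyComb_eq b' (C_mem_polyOver hw)
    refine ⟨_, polyComb_mem b (B.adjugate.mulVec v), ?_⟩
    rw [← h, Matrix.mulVec_mulVec, Matrix.mul_adjugate, Matrix.smul_mulVec, Matrix.one_mulVec,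
      ← hv, polyComb, polyComb, Finset.mul_sum]
    refine Finset.sum_congr rfl fun i _ => ?_
    rw [Pi.smul_apply, smul_eq_mul, Polynomial.map_mul, mul_assoc]

/-- If `W[y] / ξ V[y]` is annihilated by a nonzero polynomial, then `dim W ≤ dim V`. -/
theorem finrank_le_of_exists_mul_eq {ξ : Polynomial R} {c : Polynomial k} (hc : c ≠ 0)
    (h : ∀ w ∈ W, ∃ s ∈ polyOver V, c.map (algebraMap k R) * Polynomial.C w = ξ * s) :
    Module.finrank k W ≤ Module.finrank k V := by
  let b := Module.finBasis k V
  let b' := Module.finBasis k W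
  choose s hs hs' using fun l => h _ (b' l).2
  choose N hN using fun l => exists_polyComb_eq b (hs l)
  refine le_of_fin_injective (Polynomial k) (Matrix.mulVecLin (Matrix.of fun i l => N l i)) ?_
  have hNB : ∀ v : Fin (Module.finrank k W) → Polynomial k,
      ξ * polyComb (fun i => (b i : R)) ((Matrix.of fun i l => N l i).mulVec v) =
        polyComb (fun l => (b' l : R)) (c • v) := by
    intro v
    have h1 : polyComb (fun i => (b i : R)) ((Matrix.of fun i l => N l i).mulVec v) =
        ∑ l, (v l).map (algebraMap k R) * s l := by
      simp only [← hN, polyComb, Matrix.mulVec, dotProduct, Matrix.of_apply, Polynomial.map_sum,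
        Polynomial.map_mul, Finset.sum_mul, Finset.mul_sum]
      rw [Finset.sum_comm]
      refine Finset.sum_congr rfl fun i _ => Finset.sum_congr rfl fun l _ => ?_
      ring
    rw [h1, Finset.mul_sum, polyComb]
    refine Finset.sum_congr rfl fun l _ => ?_
    rw [mul_left_comm, ← hs', Pi.smul_apply, smul_eq_mul, Polynomial.map_mul]
    ring
  rw [injective_iff_map_eq_zero]
  intro v hv
  rw [Matrix.mulVecLin_apply] at hv
  have h2 := hNB v
  rw [hv, polyComb_zero, mul_zero, ← polyComb_zero (k := k) fun l => (b' l : R)] at h2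
  have h3 := polyComb_injective b' h2
  exact (smul_eq_zero.1 h3.symm).resolve_left hc

end PolynomialCoefficients

/-! ### Hilbert functions -/

section Hilbert

attribute [local instance] MvPolynomial.gradedAlgebra

variable {I J : Ideal (MvPolynomial (Fin r) k)}

theorem exists_eq_sum_X_mul {n : ℕ} {f : MvPolynomial (Fin r) k} (hf : f.IsHomogeneous (n + 1)) :
    ∃ g : Fin r → MvPolynomial (Fin r) k, (∀ j, (g j).IsHomogeneous n) ∧ f = ∑ j, X j * g j := by
  have h1 : f ∈ homogeneousSubmodule (Fin r) k 1 * homogeneousSubmodule (Fin r) k n := by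
    have h2 := homogeneousSubmodule_one_pow (σ := Fin r) (R := k)
    rw [← h2 n, ← pow_succ', h2]
    exact hf
  refine Submodule.mul_induction_on h1 (fun l hl g hg => ?_) ?_
  · rw [homogeneousSubmodule_one_eq_span_X] at hl
    obtain ⟨c, rfl⟩ := (Submodule.mem_span_range_iff_exists_fun k).1 hl
    refine ⟨fun j => c j • g, fun j => (homogeneousSubmodule (Fin r) k n).smul_mem _ hg, ?_⟩
    rw [Finset.sum_mul]
    exact Finset.sum_congr rfl fun j _ => by rw [smul_mul_assoc, mul_smul_comm]
  · rintro _ _ ⟨g, hg, rfl⟩ ⟨g', hg', rfl⟩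
    exact ⟨fun j => g j + g' j, fun j => (hg j).add (hg' j), by
      simp only [mul_add, Finset.sum_add_distrib]⟩

theorem forms_add_one_mul_X {n : ℤ} {f : MvPolynomial (Fin r) k} (hf : f ∈ forms k r n)
    (j : Fin r) : X j * f ∈ forms k r (n + 1) := by
  simpa using mul_mem_forms (isHomogeneous_X k j) hf

theorem mk_X_mul_mem {n : ℤ} {y : MvPolynomial (Fin r) k ⧸ I} (hy : y ∈ quotGrading I n)
    (j : Fin r) : Ideal.Quotient.mk I (X j) * y ∈ quotGrading I (n + 1) := by
  obtain ⟨f, hf, rfl⟩ := mem_quotGrading.1 hy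
  rw [← map_mul]
  exact mk_mem_quotGrading (forms_add_one_mul_X hf j)

instance finiteDimensional_quotGrading (I : Ideal (MvPolynomial (Fin r) k)) (n : ℤ) :
    FiniteDimensional k (quotGrading I n) := by
  cases n with
  | ofNat n =>
    exact Module.Finite.of_fg ((homogeneousSubmodule_fg (σ := Fin r) (R := k) n).map _)
  | negSucc n => exact Module.Finite.of_fg Submodule.fg_bot

/-- The Hilbert function of `S / I`. -/
def hilb (I : Ideal (MvPolynomial (Fin r) k)) (n : ℕ) : ℕ :=
  Module.finrank k (quotGrading I (n : ℤ))

/-- The generic linear form `∑ x_j y^j`, a polynomial in `y` over `S / I`. -/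
def genericForm (I : Ideal (MvPolynomial (Fin r) k)) : Polynomial (MvPolynomial (Fin r) k ⧸ I) :=
  ∑ j : Fin r, Polynomial.C (Ideal.Quotient.mk I (X j)) * Polynomial.X ^ (j : ℕ)

theorem coeff_genericForm (j : Fin r) :
    (genericForm I).coeff j = Ideal.Quotient.mk I (X j) := by
  simp [genericForm, Polynomial.finsetSum_coeff, Polynomial.coeff_C_mul, Polynomial.coeff_X_pow,
    Fin.val_inj]

/-- By McCoy's theorem, the generic linear form is regular if `I` is saturated. -/
theorem genericForm_regular (hI : IsSaturated I) (s : Polynomial (MvPolynomial (Fin r) k ⧸ I))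
    (hs : genericForm I * s = 0) : s = 0 := by
  have h : genericForm I ∈ nonZeroDivisors (Polynomial (MvPolynomial (Fin r) k ⧸ I)) := by
    refine Polynomial.mem_nonZeroDivisors_iff.2 fun a ha => ?_
    obtain ⟨f, rfl⟩ := Ideal.Quotient.mk_surjective a
    refine Ideal.Quotient.eq_zero_iff_mem.2 (hI f fun j => ⟨1, ?_⟩)
    have hj := congrArg (fun s => s.coeff (j : ℕ)) ha
    simp only [Polynomial.coeff_smul, coeff_genericForm, Polynomial.coeff_zero, smul_eq_mul,
      ← map_mul] at hj
    rw [pow_one, mul_comm]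
    exact Ideal.Quotient.eq_zero_iff_mem.1 hj
  exact (mem_nonZeroDivisors_iff.1 h).1 s hs

theorem genericForm_mul_mem {n : ℤ} {s : Polynomial (MvPolynomial (Fin r) k ⧸ I)}
    (hs : s ∈ polyOver (quotGrading I n)) :
    genericForm I * s ∈ polyOver (quotGrading I (n + 1)) := by
  rw [genericForm, Finset.sum_mul]
  refine sum_mem fun j _ m => ?_
  rw [mul_assoc, Polynomial.coeff_C_mul, Polynomial.coeff_X_pow_mul']
  split_ifs
  · exact mk_X_mul_mem (hs _) j
  · rw [mul_zero]
    exact zero_mem _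

/-- `R_{n+1}[y]` is contained in `x R_n[y]` up to multiplication by a fixed nonzero polynomial in
`y`, where `R = S / I` and `x` is the generic linear form. -/
def GenericSurjective (I : Ideal (MvPolynomial (Fin r) k)) (n : ℤ) : Prop :=
  ∃ c : Polynomial k, c ≠ 0 ∧ ∀ w ∈ quotGrading I (n + 1), ∃ s ∈ polyOver (quotGrading I n),
    c.map (algebraMap k (MvPolynomial (Fin r) k ⧸ I)) * Polynomial.C w = genericForm I * s

theorem GenericSurjective.succ {n : ℕ} (h : GenericSurjective I n) :
    GenericSurjective I (n + 1) := by
  obtain ⟨c, hc, h⟩ := h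
  refine ⟨c, hc, fun w hw => ?_⟩
  obtain ⟨f, hf, rfl⟩ := mem_quotGrading.1 hw
  obtain ⟨g, hg, rfl⟩ := exists_eq_sum_X_mul (n := n + 1) (f := f) hf
  choose s hs hs' using fun j => h _ (mk_mem_quotGrading (I := I) (n := (n : ℤ) + 1) (hg j))
  refine ⟨∑ j, Polynomial.C (Ideal.Quotient.mk I (X j)) * s j, sum_mem fun j _ m => ?_, ?_⟩
  · rw [Polynomial.coeff_C_mul]
    exact mk_X_mul_mem (hs j m) j
  · simp only [map_sum, map_mul, Finset.mul_sum]
    refine Finset.sum_congr rfl fun j _ => ?_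
    linear_combination Polynomial.C (Ideal.Quotient.mk I (X j)) * hs' j

theorem GenericSurjective.hilb_le {n : ℕ} (h : GenericSurjective I n) :
    hilb I (n + 1) ≤ hilb I n := by
  obtain ⟨c, hc, h⟩ := h
  exact finrank_le_of_exists_mul_eq hc h

theorem hilb_le_succ (hI : IsSaturated I) (n : ℕ) : hilb I n ≤ hilb I (n + 1) :=
  finrank_le_of_mul_mem (genericForm_regular hI) fun _ hs => genericForm_mul_mem hs

theorem genericSurjective_of_hilb_eq (hI : IsSaturated I) {n : ℕ}
    (h : hilb I n = hilb I (n + 1)) : GenericSurjective I n :=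
  exists_mul_eq_of_finrank_eq (genericForm_regular hI) (fun _ hs => genericForm_mul_mem hs) h

/-- The Hilbert function of `S / I` for a saturated ideal `I` is constant from the first argument
on at which it fails to grow. -/
theorem hilb_eq_of_hilb_eq_succ (hI : IsSaturated I) {n : ℕ} (h : hilb I n = hilb I (n + 1))
    {m : ℕ} (hm : n ≤ m) : hilb I m = hilb I n := by
  induction m, hm using Nat.le_induction with
  | base => rfl
  | succ m hm ih =>
    have h1 : ∀ m, n ≤ m → GenericSurjective I m := fun m hm => by
      induction m, hm using Nat.le_induction with
      | base => exact genericSurjective_of_hilb_eq hI h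
      | succ m hm ih => exact_mod_cast ih.succ
    rw [← ih]
    exact le_antisymm (h1 m hm).hilb_le (hilb_le_succ hI m)

theorem monotone_hilb (hI : IsSaturated I) : Monotone (hilb I) :=
  monotone_nat_of_le_succ (hilb_le_succ hI)

/-- The ideal generated by the forms of degree `n` of `I`. -/
def genBy (I : Ideal (MvPolynomial (Fin r) k)) (n : ℕ) : Ideal (MvPolynomial (Fin r) k) :=
  Ideal.span {f | f ∈ I ∧ f.IsHomogeneous n}

theorem genBy_le (I : Ideal (MvPolynomial (Fin r) k)) (n : ℕ) : genBy I n ≤ I :=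
  Ideal.span_le.2 fun _ hf => hf.1

theorem isHomogeneous_genBy (I : Ideal (MvPolynomial (Fin r) k)) (n : ℕ) :
    (genBy I n).IsHomogeneous (homogeneousSubmodule (Fin r) k) :=
  Ideal.homogeneous_span _ _ fun _ hf => ⟨n, hf.2⟩

theorem genericSurjective_of_le (hJI : J ≤ I) {n : ℕ}
    (h : ∀ f ∈ I, f.IsHomogeneous (n + 1) → f ∈ J) (hI : GenericSurjective I n) :
    GenericSurjective J n := by
  obtain ⟨c, hc, hI⟩ := hI
  refine ⟨c, hc, fun w hw => ?_⟩
  obtain ⟨f, hf, rfl⟩ := mem_quotGrading.1 hw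
  obtain ⟨s, hs, hs'⟩ := hI _ (mk_mem_quotGrading hf)
  have h1 : ∀ m, ∃ g ∈ forms k r n, Ideal.Quotient.mk I g = s.coeff m := fun m =>
    mem_quotGrading.1 (hs m)
  choose g hg hgs using h1
  let π : (MvPolynomial (Fin r) k ⧸ J) →ₐ[k] (MvPolynomial (Fin r) k ⧸ I) :=
    Ideal.Quotient.factorₐ k hJI
  let s' : Polynomial (MvPolynomial (Fin r) k ⧸ J) :=
    ∑ m ∈ s.support, Polynomial.monomial m (Ideal.Quotient.mk J (g m))
  have hs'J : s' ∈ polyOver (quotGrading J n) := by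
    refine sum_mem fun m _ i => ?_
    rw [Polynomial.coeff_monomial]
    split_ifs
    · exact mk_mem_quotGrading (hg m)
    · exact zero_mem _
  have hπs : s'.map π.toRingHom = s := by
    simp only [s', Polynomial.map_sum, Polynomial.map_monomial]
    nth_rewrite 2 [s.as_sum_support]
    refine Finset.sum_congr rfl fun m _ => ?_
    rw [← hgs]
    rfl
  have hπξ : (genericForm J).map π.toRingHom = genericForm I := by
    simp only [genericForm, Polynomial.map_sum, Polynomial.map_mul, Polynomial.map_pow,
      Polynomial.map_X, Polynomial.map_C]
    rfl
  refine ⟨s', hs'J, ?_⟩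
  -- the difference of both sides has coefficients in `R_{n+1}`, where `S / J` and `S / I` agree
  have hinj : ∀ y ∈ quotGrading J ((n : ℤ) + 1), π y = 0 → y = 0 := by
    intro y hy hπ
    obtain ⟨q, hq, rfl⟩ := mem_quotGrading.1 hy
    exact Ideal.Quotient.eq_zero_iff_mem.2 (h q (Ideal.Quotient.eq_zero_iff_mem.1 hπ) hq)
  rw [← sub_eq_zero]
  ext m
  rw [Polynomial.coeff_zero]
  refine hinj _ ?_ ?_
  · exact (polyOver _).sub_mem (map_mul_mem_polyOver (C_mem_polyOver hw) c)
      (genericForm_mul_mem hs'J) m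
  · have h2 : (c.map (algebraMap k (MvPolynomial (Fin r) k ⧸ J)) *
        Polynomial.C (Ideal.Quotient.mk J f) - genericForm J * s').map π.toRingHom = 0 := by
      rw [Polynomial.map_sub, Polynomial.map_mul, Polynomial.map_mul, hπs, hπξ,
        Polynomial.map_map, Polynomial.map_C, sub_eq_zero, ← hs']
      rfl
    have h3 := congrArg (fun q => q.coeff m) h2
    rwa [Polynomial.coeff_map, Polynomial.coeff_zero] at h3

/-- If `I` is saturated and the Hilbert function of `S / I` does not grow from `n` to `n + 1`, then
the forms of degree `n + 2` of `I` are generated by those of degree `n + 1`. -/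
theorem mem_genBy_of_hilb_eq (hI : IsSaturated I) {n : ℕ} (h : hilb I n = hilb I (n + 1))
    {f : MvPolynomial (Fin r) k} (hfI : f ∈ I) (hf : f.IsHomogeneous (n + 2)) :
    f ∈ genBy I (n + 1) := by
  set J := genBy I (n + 1) with hJ
  have hJI : J ≤ I := genBy_le I (n + 1)
  have hJn : ∀ f ∈ I, f.IsHomogeneous (n + 1) → f ∈ J := fun f hf hf' =>
    Ideal.subset_span ⟨hf, hf'⟩
  have hT := genericSurjective_of_le hJI hJn (genericSurjective_of_hilb_eq hI h)
  have h1 : hilb J (n + 2) ≤ hilb J (n + 1) := by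
    have := hT.succ
    exact GenericSurjective.hilb_le (n := n + 1) (by exact_mod_cast this)
  let π : (MvPolynomial (Fin r) k ⧸ J) →ₐ[k] (MvPolynomial (Fin r) k ⧸ I) :=
    Ideal.Quotient.factorₐ k hJI
  have hπ : ∀ m : ℕ, ∀ y ∈ quotGrading J (m : ℤ), π.toLinearMap y ∈ quotGrading I (m : ℤ) := by
    intro m y hy
    obtain ⟨q, hq, rfl⟩ := mem_quotGrading.1 hy
    exact mk_mem_quotGrading hq
  have h2 : hilb J (n + 1) ≤ hilb I (n + 1) := by
    refine LinearMap.finrank_le_finrank_of_injective (f := π.toLinearMap.restrict (hπ (n + 1))) ?_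
    rw [injective_iff_map_eq_zero]
    rintro ⟨y, hy⟩ hy0
    obtain ⟨q, hq, rfl⟩ := mem_quotGrading.1 hy
    have hqI : q ∈ I := Ideal.Quotient.eq_zero_iff_mem.1 (congrArg Subtype.val hy0)
    exact Subtype.ext (Ideal.Quotient.eq_zero_iff_mem.2 (hJn q hqI hq))
  have h3 : hilb I (n + 2) = hilb I (n + 1) :=
    (hilb_eq_of_hilb_eq_succ hI h (by omega)).trans h
  have hsurj : Function.Surjective (π.toLinearMap.restrict (hπ (n + 2))) := by
    rintro ⟨y, hy⟩
    obtain ⟨q, hq, rfl⟩ := mem_quotGrading.1 hy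
    exact ⟨⟨_, mk_mem_quotGrading hq⟩, rfl⟩
  have h4 : hilb J (n + 2) = hilb I (n + 2) :=
    le_antisymm (by omega) (LinearMap.finrank_le_finrank_of_surjective hsurj)
  have hinj := (LinearMap.injective_iff_surjective_of_finrank_eq_finrank h4).2 hsurj
  have hf0 : (⟨Ideal.Quotient.mk J f, mk_mem_quotGrading hf⟩ :
      quotGrading J ((n + 2 : ℕ) : ℤ)) = 0 :=
    hinj (Subtype.ext (by
      rw [map_zero]
      exact Ideal.Quotient.eq_zero_iff_mem.2 hfI))
  exact Ideal.Quotient.eq_zero_iff_mem.1 (congrArg Subtype.val hf0)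

end Hilbert

/-! ### Dimensions of subquotients -/

section Subquotient

variable {V V' V'' : Type v} [AddCommGroup V] [Module k V] [AddCommGroup V'] [Module k V']
  [AddCommGroup V''] [Module k V''] {Z B : Submodule k V} {Z' B' : Submodule k V'}
  {Z'' B'' : Submodule k V''}

/-- The map `Z / B → Z' / B'` of subquotients induced by a linear map. -/
def subquotMap (f : V →ₗ[k] V') (hZ : ∀ z ∈ Z, f z ∈ Z') (hB : ∀ z ∈ B, f z ∈ B') :
    (Z ⧸ B.submoduleOf Z) →ₗ[k] (Z' ⧸ B'.submoduleOf Z') :=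
  Submodule.mapQ _ _ (f.restrict hZ) fun z hz => hB z.1 hz

theorem subsingleton_subquot_iff :
    Subsingleton (Z ⧸ B.submoduleOf Z) ↔ Z ≤ B := by
  rw [Submodule.Quotient.subsingleton_iff, Submodule.submoduleOf_eq_top]

theorem finiteDimensional_of_rank_le {n : ℕ} (h : Module.rank k V ≤ n) : FiniteDimensional k V :=
  Module.rank_lt_aleph0_iff.1 (h.trans_lt Cardinal.natCast_lt_aleph0)

theorem finrank_le_of_rank_le {n : ℕ} (h : Module.rank k V ≤ n) : Module.finrank k V ≤ n := by
  have := finiteDimensional_of_rank_le h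
  rw [← Module.finrank_eq_rank k] at h
  exact_mod_cast h

/-- Subadditivity of the dimension for a complex `Z / B → Z' / B' → Z'' / B''` that is exact in the
middle. -/
theorem rank_subquot_le (f : V →ₗ[k] V') (g : V' →ₗ[k] V'') (hfZ : ∀ z ∈ Z, f z ∈ Z')
    (hfB : ∀ z ∈ B, f z ∈ B') (hgZ : ∀ z ∈ Z', g z ∈ Z'') (hgB : ∀ z ∈ B', g z ∈ B'')
    (hfg : ∀ z ∈ Z', g z ∈ B'' → ∃ y ∈ Z, z - f y ∈ B') :
    Module.rank k (Z' ⧸ B'.submoduleOf Z') ≤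
      Module.rank k (Z ⧸ B.submoduleOf Z) + Module.rank k (Z'' ⧸ B''.submoduleOf Z'') := by
  rw [← LinearMap.rank_range_add_rank_ker (subquotMap g hgZ hgB), add_comm]
  refine add_le_add ?_ (Submodule.rank_le _)
  refine le_trans (Submodule.rank_mono ?_) (rank_range_le (subquotMap f hfZ hfB))
  intro y hy
  obtain ⟨⟨z, hz⟩, rfl⟩ := Submodule.Quotient.mk_surjective _ y
  have hgz : g z ∈ B'' := by
    have := (Submodule.Quotient.mk_eq_zero _).1 hy
    exact this
  obtain ⟨y, hy, hzy⟩ := hfg z hz hgz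
  refine ⟨Submodule.Quotient.mk ⟨y, hy⟩, ((Submodule.Quotient.eq _).2 ?_).symm⟩
  exact hzy

/-- A surjection `Z / B → Z' / B'` with a nonzero kernel lowers the dimension. -/
theorem finrank_subquot_lt (f : V →ₗ[k] V') (hfZ : ∀ z ∈ Z, f z ∈ Z')
    (hfB : ∀ z ∈ B, f z ∈ B') [FiniteDimensional k (Z ⧸ B.submoduleOf Z)]
    (hsurj : ∀ z ∈ Z', ∃ y ∈ Z, z - f y ∈ B') {c : V} (hc : c ∈ Z) (hcB : c ∉ B)
    (hfc : f c ∈ B') :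
    Module.finrank k (Z' ⧸ B'.submoduleOf Z') < Module.finrank k (Z ⧸ B.submoduleOf Z) := by
  have h1 : Function.Surjective (subquotMap f hfZ hfB) := by
    intro y
    obtain ⟨⟨z, hz⟩, rfl⟩ := Submodule.Quotient.mk_surjective _ y
    obtain ⟨y, hy, hzy⟩ := hsurj z hz
    refine ⟨Submodule.Quotient.mk ⟨y, hy⟩, ((Submodule.Quotient.eq _).2 ?_).symm⟩
    exact hzy
  rw [← (subquotMap f hfZ hfB).finrank_range_add_finrank_ker, LinearMap.range_eq_top.2 h1,
    finrank_top]
  refine Nat.lt_add_of_pos_right ?_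
  rw [Module.finrank_pos_iff_exists_ne_zero]
  refine ⟨⟨Submodule.Quotient.mk ⟨c, hc⟩, (Submodule.Quotient.mk_eq_zero _).2 hfc⟩, fun h => ?_⟩
  have h2 : (⟨c, hc⟩ : Z) ∈ B.submoduleOf Z :=
    (Submodule.Quotient.mk_eq_zero _).1 (congrArg Subtype.val h)
  exact hcB h2

end Subquotient

/-! ### Cohomology of a section in terms of dimensions -/

section Section

attribute [local instance] MvPolynomial.gradedAlgebra

variable {I J : Ideal (MvPolynomial (Fin r) k)} {x : MvPolynomial (Fin r) k} {e : ℕ}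

theorem smul_mem_cocycles {p : ℕ} {n n' : ℤ} (hx : x.IsHomogeneous e) (hn : n = n' + e)
    {c : Cech (k := k) (r := r) (MvPolynomial (Fin r) k ⧸ I) p}
    (hc : c ∈ cocycles r (quotGrading I) p n') : x • c ∈ cocycles r (quotGrading I) p n := by
  subst hn
  obtain ⟨hc, hdc⟩ := mem_cocycles.1 hc
  exact mem_cocycles.2 ⟨smul_mem_cechDegree (isGradedFamily_quotGrading I) hc hx, by
    rw [map_smul, hdc, smul_zero]⟩

/-- If multiplication by a form `x` of positive degree is injective on `H^{p+1}(S/I)` in all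
degrees from `n` on, then `H^{p+1}(S/I)_n = 0`. -/
theorem cocycles_le_coboundaries_of_injective (he : 0 < e) (hx : x.IsHomogeneous e) {p : ℕ} {n : ℤ}
    (hinj : ∀ n' : ℤ, n ≤ n' → ∀ c : Cech (k := k) (r := r) (MvPolynomial (Fin r) k ⧸ I) (p + 1),
      x • c ∈ coboundaries r (quotGrading I) (p + 1) (n' + e) →
        c ∈ coboundaries r (quotGrading I) (p + 1) n') :
    cocycles r (quotGrading I) (p + 1) n ≤ coboundaries r (quotGrading I) (p + 1) n := by
  intro c hc
  obtain ⟨a, ha⟩ := exists_pow_smul_mem_coboundaries (isGradedFamily_quotGrading I) hc he hx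
  induction a with
  | zero => simpa using ha
  | succ a ih =>
    refine ih (hinj _ (by omega) _ ?_)
    rw [pow_succ', mul_smul] at ha
    have hn : n + ((e * (a + 1) : ℕ) : ℤ) = n + ((e * a : ℕ) : ℤ) + e := by
      push_cast
      ring
    rwa [hn] at ha

namespace IsSection

variable (h : IsSection I J x e)

include h

/-- `H^{p+2}(S/I)_n` vanishes if `H^{p+1}(S/J)` vanishes in all degrees larger than `n`. -/
theorem cocycles_le_coboundaries (he : 0 < e) {p : ℕ} {n : ℤ}
    (hJ : ∀ n' : ℤ, n < n' →
      cocycles r (quotGrading J) (p + 1) n' ≤ coboundaries r (quotGrading J) (p + 1) n') :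
    cocycles r (quotGrading I) (p + 2) n ≤ coboundaries r (quotGrading I) (p + 2) n := by
  refine cocycles_le_coboundaries_of_injective he h.form fun n' hn c hc => ?_
  have := h.mem_coboundaries_of_smul_mem (hJ (n' + e) (by omega)) hc
  rwa [add_sub_cancel_right] at this

/-- `dim H^1(S/I)_n ≤ dim H^1(S/I)_{n-e} + dim H^1(S/J)_n`. -/
theorem rank_localCoh_le {n n' : ℤ} (hn : n = n' + e) :
    Module.rank k (localCoh r (quotGrading I) 1 n) ≤
      Module.rank k (localCoh r (quotGrading I) 1 n') +
        Module.rank k (localCoh r (quotGrading J) 1 n) := by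
  obtain rfl : n' = n - e := by omega
  refine rank_subquot_le ((LinearMap.lsmul (MvPolynomial (Fin r) k) _ x).restrictScalars k)
    ((cechMap (quotProj h.le) 1).restrictScalars k) (fun c hc => smul_mem_cocycles h.form hn hc)
    (fun c hc => ?_) (fun c hc => ?_) (fun c hc => ?_) (fun c hc hcJ => ?_)
  · have := smul_mem_coboundaries (isGradedFamily_quotGrading I) hc h.form
    rwa [← hn] at this
  · obtain ⟨hc, hdc⟩ := mem_cocycles.1 hc
    refine mem_cocycles.2 ⟨h.cechMap_quotProj_mem hc, ?_⟩
    rw [LinearMap.restrictScalars_apply, cechD_cechMap, hdc, map_zero]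
  · obtain ⟨b, hb, rfl⟩ := mem_coboundaries.1 hc
    exact mem_coboundaries.2 ⟨_, h.cechMap_quotProj_mem hb, cechD_cechMap _ _ _⟩
  · exact h.exists_cocycle_sub_mem hc hcJ

/-- If `H^1(S/J)_n = 0`, then multiplication by `x` maps `H^1(S/I)_{n-e}` onto `H^1(S/I)_n`, with a
kernel that is not zero as soon as `J` and `I + (x)` differ in degree `n`. -/
theorem finrank_localCoh_lt (hI : IsSaturated I) {n n' : ℤ} (hn : n = n' + e)
    (hJ : cocycles r (quotGrading J) 1 n ≤ coboundaries r (quotGrading J) 1 n)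
    [FiniteDimensional k (localCoh r (quotGrading I) 1 n')]
    {f : MvPolynomial (Fin r) k} (hf : f ∈ forms k r n) (hfJ : f ∈ J)
    (hfI : f ∉ I ⊔ Ideal.span {x}) :
    Module.finrank k (localCoh r (quotGrading I) 1 n) <
      Module.finrank k (localCoh r (quotGrading I) 1 n') := by
  obtain rfl : n' = n - e := by omega
  obtain ⟨c, hc, hcB, hxc⟩ := h.exists_cocycle_smul_mem hI hf hfJ hfI
  refine finrank_subquot_lt ((LinearMap.lsmul (MvPolynomial (Fin r) k) _ x).restrictScalars k)
    (fun c hc => smul_mem_cocycles h.form hn hc) (fun c hc => ?_) (fun c hc => ?_) hc hcB hxc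
  · have := smul_mem_coboundaries (isGradedFamily_quotGrading I) hc h.form
    rwa [← hn] at this
  · obtain ⟨hc', hdc⟩ := mem_cocycles.1 hc
    exact h.exists_cocycle_sub_mem hc (hJ (mem_cocycles.2 ⟨h.cechMap_quotProj_mem hc', by
      rw [cechD_cechMap, hdc, map_zero]⟩))

end IsSection

/-- Bounds for the cohomology of `S / I` and for the degrees of the generators of `I`: the
regularity of `S / I` is at most `m`, the dimension of `H^1(S/I)_n` is at most `B n` for `n ≥ 0`,
and `I` has no minimal generators of degree larger than `m + 1`. -/
structure IsBounded (I : Ideal (MvPolynomial (Fin r) k)) (m : ℕ) (B : ℕ → ℕ) : Prop where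
  vanish : ∀ (p : ℕ) (n : ℤ), (m : ℤ) < n + p →
    cocycles r (quotGrading I) p n ≤ coboundaries r (quotGrading I) p n
  rank_le : ∀ n : ℕ, Module.rank k (localCoh r (quotGrading I) 1 n) ≤ B n
  gen : ∀ n : ℕ, m + 1 ≤ n → ∀ f ∈ I, f.IsHomogeneous (n + 1) → f ∈ genBy I n

/-- Bounds for a hyperplane section lift to bounds for `S / I`. From degree `m` on, each step of
`dim H^1(S/I)_n` either is a strict drop or `J` and `I + (x)` agree in that degree. In the second
case they agree in all higher degrees, since `J` has no new generators there, hence multiplication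
by `x` is injective on `H^1(S/I)` from that point on, and so `H^1(S/I)` has become zero. The
dimension at degree `m` is at most `B' m`, which bounds the number of drops. -/
theorem IsSection.isBounded (h : IsSection I J x 1) (hI : IsSaturated I) (hJ : IsSaturated J)
    {m t : ℕ} {B : ℕ → ℕ} (hB : IsBounded J m B)
    (ht : Module.rank k (localCoh r (quotGrading I) 1 0) ≤ t) {B' : ℕ → ℕ}
    (hB' : ∀ n, B' n = t + ∑ i ∈ Finset.range n, B (i + 1)) :
    IsBounded I (m + B' m) B' := by
  have hrank : ∀ n : ℕ, Module.rank k (localCoh r (quotGrading I) 1 n) ≤ B' n := by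
    intro n
    induction n with
    | zero => simpa [hB'] using ht
    | succ n ih =>
      refine (h.rank_localCoh_le (n' := n) (by push_cast; ring)).trans ?_
      refine (add_le_add ih (hB.rank_le (n + 1))).trans (le_of_eq ?_)
      rw [hB', hB', Finset.sum_range_succ]
      push_cast
      ring
  have hfin : ∀ n : ℕ, FiniteDimensional k (localCoh r (quotGrading I) 1 n) := fun n =>
    finiteDimensional_of_rank_le (hrank n)
  have hvan1 : ∀ n : ℕ, m + B' m ≤ n →
      cocycles r (quotGrading I) 1 n ≤ coboundaries r (quotGrading I) 1 n := by
    intro n hn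
    by_contra hne
    -- in each degree from `m + 1` to `n + 1`, some form of `J` is not in `I + (x)`
    have h1 : ∀ i : ℕ, m + 1 ≤ i → i ≤ n + 1 →
        ∃ f ∈ forms k r i, f ∈ J ∧ f ∉ I ⊔ Ideal.span {x} := by
      intro i hmi hin
      by_contra! hi
      have h2 : ∀ j : ℕ, i ≤ j → ∀ f ∈ forms k r j, f ∈ J → f ∈ I ⊔ Ideal.span {x} := by
        intro j hij
        induction j, hij using Nat.le_induction with
        | base => exact hi
        | succ j hij ih =>
          intro f hf hfJ
          have h3 : genBy J j ≤ I ⊔ Ideal.span {x} :=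
            Ideal.span_le.2 fun g hg => ih g hg.2 hg.1
          exact h3 (hB.gen j (by omega) f hfJ hf)
      refine hne (cocycles_le_coboundaries_of_injective one_pos h.form fun n' hn' c hc => ?_)
      lift n' to ℕ using by omega
      have := h.mem_coboundaries_one_of_smul_mem hJ (n := n' + (1 : ℕ))
        (h2 (n' + 1) (by omega)) hc
      rwa [add_sub_cancel_right] at this
    have h2 : ∀ j : ℕ, m + j ≤ n + 1 →
        Module.finrank k (localCoh r (quotGrading I) 1 ((m + j : ℕ) : ℤ)) + j ≤ B' m := by
      intro j
      induction j with
      | zero =>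
        intro _
        exact finrank_le_of_rank_le (hrank m)
      | succ j ih =>
        intro hj
        obtain ⟨f, hf, hfJ, hfI⟩ := h1 (m + (j + 1)) (by omega) hj
        have := hfin (m + j)
        have h3 := h.finrank_localCoh_lt hI (n := ((m + (j + 1) : ℕ) : ℤ))
          (n' := ((m + j : ℕ) : ℤ)) (by push_cast; ring)
          (hB.vanish 1 _ (by push_cast; omega)) hf hfJ hfI
        have h4 := ih (by omega)
        omega
    have h3 := h2 (n + 1 - m) (by omega)
    omega
  refine ⟨fun p n hpn => ?_, hrank, fun n hn f hfI hf => ?_⟩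
  · match p with
    | 0 => exact (cocycles_zero_eq_bot hI n).trans_le bot_le
    | 1 =>
      lift n to ℕ using by push_cast at hpn; omega
      exact hvan1 n (by push_cast at hpn; omega)
    | p + 2 =>
      exact h.cocycles_le_coboundaries one_pos fun n' hn' => hB.vanish (p + 1) n' (by
        push_cast at hpn ⊢; omega)
  · have h1 : ∀ g ∈ forms k r n, g ∈ J → g ∈ I ⊔ Ideal.span {x} := by
      intro g hg hgJ
      by_contra hgI
      obtain ⟨c, hc, hcB, -⟩ := h.exists_cocycle_smul_mem hI hg hgJ hgI
      have hn1 : (n : ℤ) - (1 : ℕ) = ((n - 1 : ℕ) : ℤ) := by omega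
      rw [hn1] at hc hcB
      exact hcB (hvan1 (n - 1) (by omega) hc)
    have h2 : genBy J n ≤ genBy I n ⊔ Ideal.span {x} := by
      refine Ideal.span_le.2 fun g hg => ?_
      obtain ⟨a, ha, s, -, haf, rfl⟩ := exists_form_of_mem_sup_span h.homogeneous h.form
        (n := n) hg.2 (h1 g hg.2 hg.1)
      exact add_mem (Ideal.mem_sup_left (Ideal.subset_span ⟨ha, haf⟩))
        (Ideal.mem_sup_right (Ideal.mem_span_singleton.2 (dvd_mul_right _ _)))
    obtain ⟨a, ha, s, hs, -, rfl⟩ := exists_form_of_mem_sup_span (isHomogeneous_genBy I n) h.form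
      (n := ((n + 1 : ℕ) : ℤ)) hf (h2 (hB.gen n (by omega) f (h.le hfI) hf))
    have hsI : s ∈ I := h.regular s ((I.add_mem_iff_right (genBy_le I n ha)).1 hfI)
    have hn1 : ((n + 1 : ℕ) : ℤ) - (1 : ℕ) = (n : ℤ) := by push_cast; ring
    rw [hn1] at hs
    exact add_mem ha ((genBy I n).mul_mem_left x (Ideal.subset_span ⟨hsI, hs⟩))

end Section

/-! ### Dimension at most one -/

section DimensionOne

attribute [local instance] MvPolynomial.gradedAlgebra

variable {I J : Ideal (MvPolynomial (Fin r) k)} {x : MvPolynomial (Fin r) k} {e : ℕ}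

/-- A homogeneous ideal with Artinian quotient contains all forms of large degree. -/
theorem exists_forms_mem_of_isArtinianRing
    (hI : I.IsHomogeneous (homogeneousSubmodule (Fin r) k))
    (hA : IsArtinianRing (MvPolynomial (Fin r) k ⧸ I)) :
    ∃ N : ℕ, ∀ n, N ≤ n → ∀ f : MvPolynomial (Fin r) k, f.IsHomogeneous n → f ∈ I := by
  -- the ideals of polynomials all of whose terms have degree at least `n`
  let 𝔫 : ℕ → Ideal (MvPolynomial (Fin r) k) := fun n =>
    Ideal.span ((fun s => monomial s (1 : k)) '' {s | n ≤ s.degree})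
  have mem𝔫 : ∀ n f, f ∈ 𝔫 n ↔ ∀ s ∈ f.support, n ≤ s.degree := by
    intro n f
    rw [mem_ideal_span_monomial_image]
    refine forall₂_congr fun s _ => ⟨fun ⟨s', h, hs'⟩ => le_trans h ?_, fun h => ⟨s, h, le_rfl⟩⟩
    exact Finsupp.degree_mono hs'
  have h𝔫 : Antitone 𝔫 := fun a b hab f hf =>
    (mem𝔫 _ _).2 fun s hs => hab.trans ((mem𝔫 _ _).1 hf s hs)
  obtain ⟨N, hN⟩ := IsArtinian.monotone_stabilizes (R := MvPolynomial (Fin r) k ⧸ I)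
    (M := MvPolynomial (Fin r) k ⧸ I)
    ⟨fun n => OrderDual.toDual ((𝔫 n).map (Ideal.Quotient.mk I)), fun a b hab =>
      Ideal.map_mono (h𝔫 hab)⟩
  refine ⟨N, fun n hn f hf => ?_⟩
  have hfn : f ∈ 𝔫 n := (mem𝔫 _ _).2 fun s hs => by
    by_contra hlt
    exact mem_support_iff.1 hs (hf.coeff_eq_zero (by omega))
  have heq : (𝔫 n).map (Ideal.Quotient.mk I) = (𝔫 (n + 1)).map (Ideal.Quotient.mk I) :=
    (hN n hn).symm.trans (hN (n + 1) (by omega))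
  have hf' : f ∈ 𝔫 (n + 1) ⊔ I := by
    rw [← Ideal.mem_quotient_iff_mem_sup, ← heq]
    exact Ideal.mem_map_of_mem _ hfn
  obtain ⟨a, ha, b, hb, rfl⟩ := Submodule.mem_sup.1 hf'
  have ha0 : homogeneousComponent n a = 0 := by
    ext s
    rw [coeff_homogeneousComponent, coeff_zero]
    split_ifs with hs
    · by_contra hne
      have := (mem𝔫 _ _).1 ha s (mem_support_iff.2 hne)
      omega
    · rfl
  rw [← homogeneousComponent_eq_self hf, map_add, ha0, zero_add]
  exact homogeneousComponent_mem_of_mem hI hb n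

theorem isHomogeneous_sup_span (hI : I.IsHomogeneous (homogeneousSubmodule (Fin r) k))
    (hx : x.IsHomogeneous e) :
    (I ⊔ Ideal.span {x}).IsHomogeneous (homogeneousSubmodule (Fin r) k) :=
  hI.sup (Ideal.homogeneous_span _ _ fun _ hf => ⟨e, by rwa [Set.mem_singleton_iff.1 hf]⟩)

theorem ringKrullDim_quotient_sup_span_add_one_le
    (hx : Ideal.Quotient.mk I x ∈ nonZeroDivisors (MvPolynomial (Fin r) k ⧸ I)) :
    ringKrullDim (MvPolynomial (Fin r) k ⧸ I ⊔ Ideal.span {x}) + 1 ≤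
      ringKrullDim (MvPolynomial (Fin r) k ⧸ I) := by
  have h := ringKrullDim_quotient_succ_le_of_nonZeroDivisor hx
  rw [← Set.image_singleton, ← Ideal.map_span] at h
  exact (add_le_add_left (ringKrullDim_le_of_surjective
    (DoubleQuot.quotQuotEquivQuotSup I (Ideal.span {x})).toRingHom
    (DoubleQuot.quotQuotEquivQuotSup I (Ideal.span {x})).surjective) 1).trans h

theorem mk_mem_nonZeroDivisors (hx : ∀ s, x * s ∈ I → s ∈ I) :
    Ideal.Quotient.mk I x ∈ nonZeroDivisors (MvPolynomial (Fin r) k ⧸ I) := by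
  refine mem_nonZeroDivisors_iff_right.2 fun y hy => ?_
  obtain ⟨s, rfl⟩ := Ideal.Quotient.mk_surjective y
  rw [← map_mul, mul_comm] at hy
  exact Ideal.Quotient.eq_zero_iff_mem.2 (hx s (Ideal.Quotient.eq_zero_iff_mem.1 hy))

/-- In dimension at most one, the ideal `I + (x)` contains a power of the maximal graded ideal. -/
theorem exists_forms_mem_sup_span (hI : I.IsHomogeneous (homogeneousSubmodule (Fin r) k))
    (hdim : ringKrullDim (MvPolynomial (Fin r) k ⧸ I) ≤ 1) (hx : x.IsHomogeneous e)
    (hreg : ∀ s, x * s ∈ I → s ∈ I) :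
    ∃ N : ℕ, ∀ n, N ≤ n → ∀ f : MvPolynomial (Fin r) k, f.IsHomogeneous n →
      f ∈ I ⊔ Ideal.span {x} := by
  refine exists_forms_mem_of_isArtinianRing (isHomogeneous_sup_span hI hx) ?_
  rw [isArtinianRing_iff_krullDimLE_zero, Ring.krullDimLE_iff]
  have h := (ringKrullDim_quotient_sup_span_add_one_le (mk_mem_nonZeroDivisors hreg)).trans hdim
  generalize ringKrullDim (MvPolynomial (Fin r) k ⧸ I ⊔ Ideal.span {x}) = d at h ⊢
  induction d using WithBot.recBotCoe with
  | bot => exact bot_le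
  | coe d =>
    have h' : d + 1 ≤ 1 := by exact_mod_cast h
    have : d = 0 := by
      induction d using ENat.recTopCoe with
      | top => simp at h'
      | coe d =>
        have : d + 1 ≤ 1 := by exact_mod_cast h'
        simp only [Nat.cast_eq_zero]
        omega
    simp [this]

/-- In dimension at most one, a regular form has the unit ideal as section up to saturation. -/
theorem isSection_top (hI : I.IsHomogeneous (homogeneousSubmodule (Fin r) k))
    (hdim : ringKrullDim (MvPolynomial (Fin r) k ⧸ I) ≤ 1) (hx : x.IsHomogeneous e)
    (hreg : ∀ s, x * s ∈ I → s ∈ I) : IsSection I ⊤ x e := by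
  obtain ⟨N, hN⟩ := exists_forms_mem_sup_span hI hdim hx hreg
  exact ⟨hI, hx, hreg, le_top, trivial, fun f _ j => ⟨N, Ideal.mul_mem_right _ _
    (hN N le_rfl _ (isHomogeneous_X_pow j N))⟩⟩

theorem subsingleton_cech_quotient_top (p : ℕ) :
    Subsingleton (Cech (k := k) (r := r) (MvPolynomial (Fin r) k ⧸
      (⊤ : Ideal (MvPolynomial (Fin r) k))) p) := by
  refine ⟨fun c c' => funext fun σ => ?_⟩
  have h : ∀ z : LocalizedModule (monomials k σ.1) (MvPolynomial (Fin r) k ⧸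
      (⊤ : Ideal (MvPolynomial (Fin r) k))), z = 0 := by
    intro z
    induction z using LocalizedModule.induction_on with
    | h m u =>
      rw [Subsingleton.elim m 0]
      exact LocalizedModule.zero_mk u
  rw [h (c σ), h (c' σ)]

theorem cocycles_top_le (p : ℕ) (n : ℤ) :
    cocycles r (quotGrading (⊤ : Ideal (MvPolynomial (Fin r) k))) p n ≤
      coboundaries r (quotGrading (⊤ : Ideal (MvPolynomial (Fin r) k))) p n := by
  intro c _
  have := subsingleton_cech_quotient_top (k := k) (r := r) p
  rw [Subsingleton.elim c 0]
  exact zero_mem _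

/-- Multiplication by a regular form of degree `e` identifies `R_n` with its image in `R_{n+e}`,
where `R = S / I`. -/
theorem mem_sup_span_iff_hilb_eq (hI : I.IsHomogeneous (homogeneousSubmodule (Fin r) k))
    (hx : x.IsHomogeneous e) (hreg : ∀ s, x * s ∈ I → s ∈ I) (n : ℕ) :
    (∀ f : MvPolynomial (Fin r) k, f.IsHomogeneous (n + e) → f ∈ I ⊔ Ideal.span {x}) ↔
      hilb I (n + e) = hilb I n := by
  let φ : quotGrading I (n : ℤ) →ₗ[k] quotGrading I ((n + e : ℕ) : ℤ) :=
    ((LinearMap.lsmul (MvPolynomial (Fin r) k) (MvPolynomial (Fin r) k ⧸ I) x).restrictScalars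
      k).restrict fun m hm => by
        rw [Nat.cast_add]
        exact isGradedFamily_quotGrading I e x hx n m hm
  have hφ : Function.Injective φ := by
    rw [injective_iff_map_eq_zero]
    rintro ⟨y, hy⟩ hy0
    obtain ⟨s, rfl⟩ := Ideal.Quotient.mk_surjective y
    exact Subtype.ext (Ideal.Quotient.eq_zero_iff_mem.2 (hreg s
      (Ideal.Quotient.eq_zero_iff_mem.1 (congrArg Subtype.val hy0))))
  constructor
  · intro h
    refine (LinearEquiv.finrank_eq (LinearEquiv.ofBijective φ ⟨hφ, ?_⟩)).symm
    rintro ⟨y, hy⟩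
    obtain ⟨f, hf, rfl⟩ := mem_quotGrading.1 hy
    obtain ⟨a, ha, s, hs, -, rfl⟩ := exists_form_of_mem_sup_span hI hx hf (h f hf)
    have hn : ((n + e : ℕ) : ℤ) - e = n := by push_cast; ring
    rw [hn] at hs
    refine ⟨⟨_, mk_mem_quotGrading hs⟩, Subtype.ext ?_⟩
    exact Ideal.Quotient.eq.2 (by simpa using ha)
  · intro h f hf
    have hsurj := (LinearMap.injective_iff_surjective_of_finrank_eq_finrank h.symm).1 hφ
    obtain ⟨⟨y, hy⟩, hyf⟩ := hsurj ⟨_, mk_mem_quotGrading (n := ((n + e : ℕ) : ℤ)) hf⟩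
    obtain ⟨s, rfl⟩ := Ideal.Quotient.mk_surjective y
    have h1 : f - x * s ∈ I := by
      rw [← Ideal.Quotient.eq]
      exact (congrArg Subtype.val hyf).symm
    rw [← sub_add_cancel f (x * s)]
    exact add_mem (Ideal.mem_sup_left h1)
      (Ideal.mem_sup_right (Ideal.mem_span_singleton.2 (dvd_mul_right _ _)))

/-- The Hilbert function of a ring of dimension at most one that has a regular form of positive
degree is eventually constant. -/
theorem exists_hilb_eq (hI : I.IsHomogeneous (homogeneousSubmodule (Fin r) k))
    (hsat : IsSaturated I) (hdim : ringKrullDim (MvPolynomial (Fin r) k ⧸ I) ≤ 1) (he : 0 < e)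
    (hx : x.IsHomogeneous e) (hreg : ∀ s, x * s ∈ I → s ∈ I) :
    ∃ N : ℕ, ∀ n, N ≤ n → hilb I n = hilb I N := by
  obtain ⟨N, hN⟩ := exists_forms_mem_sup_span hI hdim hx hreg
  have h1 := (mem_sup_span_iff_hilb_eq hI hx hreg N).1 fun f hf => hN _ (by omega) f hf
  have h2 : hilb I N = hilb I (N + 1) :=
    le_antisymm (hilb_le_succ hsat N) (h1 ▸ monotone_hilb hsat (by omega))
  exact ⟨N, fun n hn => hilb_eq_of_hilb_eq_succ hsat h2 hn⟩

theorem finrank_coboundaries_one (hsat : IsSaturated I) (n : ℕ) :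
    FiniteDimensional k (coboundaries r (quotGrading I) 1 (n : ℤ)) ∧
      Module.finrank k (coboundaries r (quotGrading I) 1 (n : ℤ)) = hilb I n := by
  let δ : (MvPolynomial (Fin r) k ⧸ I) →ₗ[k]
      Cech (k := k) (r := r) (MvPolynomial (Fin r) k ⧸ I) 1 :=
    ((cechD _ 0).comp (toCechZero k r _)).restrictScalars k
  have hδ : Function.Injective δ := by
    rw [injective_iff_map_eq_zero]
    intro y hy
    obtain ⟨f, rfl⟩ := Ideal.Quotient.mk_surjective y
    exact Ideal.Quotient.eq_zero_iff_mem.2 (mem_of_cechD_toCechZero hsat hy)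
  have h1 : coboundaries r (quotGrading I) 1 (n : ℤ) = (quotGrading I (n : ℤ)).map δ := by
    ext c
    rw [mem_coboundaries, Submodule.mem_map]
    constructor
    · rintro ⟨b, hb, rfl⟩
      obtain ⟨m, hm, rfl⟩ := exists_toCechZero_eq (isGradedFamily_quotGrading I) hb
      exact ⟨m, hm, rfl⟩
    · rintro ⟨m, hm, rfl⟩
      exact ⟨_, toCechZero_mem_cechDegree hm, rfl⟩
  rw [h1]
  exact ⟨inferInstance, (LinearEquiv.finrank_eq (Submodule.equivMapOfInjective δ hδ _)).symm⟩

/-- In dimension one, `dim H^1(S/I)_n = E - h(n)` for `n ≥ 0`, where `h` is the Hilbert function of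
`S / I` and `E` its final value. -/
theorem finrank_localCoh_one (hI : I.IsHomogeneous (homogeneousSubmodule (Fin r) k))
    (hsat : IsSaturated I) (hdim : ringKrullDim (MvPolynomial (Fin r) k ⧸ I) ≤ 1) (he : 0 < e)
    (hx : x.IsHomogeneous e) (hreg : ∀ s, x * s ∈ I → s ∈ I) {N : ℕ}
    (hN : ∀ n, N ≤ n → hilb I n = hilb I N) (n : ℕ) :
    FiniteDimensional k (localCoh r (quotGrading I) 1 (n : ℤ)) ∧
      Module.finrank k (localCoh r (quotGrading I) 1 (n : ℤ)) + hilb I n = hilb I N := by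
  -- a power of `x` of degree at least `N`
  obtain ⟨e', y, he', hNe, hy, hyreg⟩ : ∃ (e' : ℕ) (y : MvPolynomial (Fin r) k), 0 < e' ∧ N ≤ e' ∧
      y.IsHomogeneous e' ∧ ∀ s, y * s ∈ I → s ∈ I := by
    refine ⟨e * (N + 1), x ^ (N + 1), by positivity, by nlinarith, hx.pow _, ?_⟩
    generalize N + 1 = a
    induction a with
    | zero => simp
    | succ a ih =>
      intro s hs
      rw [pow_succ', mul_assoc] at hs
      exact ih s (hreg _ hs)
  have h := isSection_top hI hdim hy hyreg
  have hG := isGradedFamily_quotGrading I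
  have hvan : ∀ m : ℕ, N ≤ m →
      cocycles r (quotGrading I) 1 (m : ℤ) ≤ coboundaries r (quotGrading I) 1 (m : ℤ) := by
    intro m hm
    refine cocycles_le_coboundaries_of_injective he' hy fun m' hm' c hc => ?_
    lift m' to ℕ using by omega
    have h1 := (mem_sup_span_iff_hilb_eq hI hy hyreg m').2
      ((hN _ (by omega)).trans (hN _ (by omega)).symm)
    have := h.mem_coboundaries_one_of_smul_mem (n := m' + e') (fun _ _ => trivial)
      (fun f hf _ => h1 f (mem_forms_natCast.1 (by exact_mod_cast hf))) hc
    rwa [add_sub_cancel_right] at this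
  -- multiplication by `y` identifies the cocycles of degree `n` with the coboundaries of
  -- degree `n + e'`
  have hmap : (cocycles r (quotGrading I) 1 (n : ℤ)).map
      ((LinearMap.lsmul (MvPolynomial (Fin r) k) (Cech (k := k) (r := r)
        (MvPolynomial (Fin r) k ⧸ I) 1) y).restrictScalars k) =
      coboundaries r (quotGrading I) 1 ((n + e' : ℕ) : ℤ) := by
    apply le_antisymm
    · rintro _ ⟨c, hc, rfl⟩
      exact hvan (n + e') (by omega) (smul_mem_cocycles hy (by push_cast; ring) hc)
    · intro c hc
      obtain ⟨hc', hdc⟩ := mem_cocycles.1 (coboundaries_le_cocycles hG 1 _ hc)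
      have := subsingleton_cech_quotient_top (k := k) (r := r) 1
      obtain ⟨b, hb, hbc⟩ := h.exists_smul_eq_of_cechMap_eq_zero hc' (Subsingleton.elim _ _)
      have hn : ((n + e' : ℕ) : ℤ) - e' = n := by push_cast; ring
      rw [hn] at hb
      refine ⟨b, mem_cocycles.2 ⟨hb, h.smul_injective _ ?_⟩, hbc⟩
      rw [← map_smul, hbc, hdc, smul_zero]
  have hinj : Function.Injective ((LinearMap.lsmul (MvPolynomial (Fin r) k)
      (Cech (k := k) (r := r) (MvPolynomial (Fin r) k ⧸ I) 1) y).restrictScalars k) :=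
    fun _ _ hcc => h.smul_injective _ hcc
  have hequiv := Submodule.equivMapOfInjective _ hinj (cocycles r (quotGrading I) 1 (n : ℤ))
  rw [hmap] at hequiv
  obtain ⟨hf1, hd1⟩ := finrank_coboundaries_one hsat (n + e')
  obtain ⟨hf2, hd2⟩ := finrank_coboundaries_one hsat n
  have hfZ : FiniteDimensional k (cocycles r (quotGrading I) 1 (n : ℤ)) :=
    Module.Finite.equiv hequiv.symm
  refine ⟨inferInstance, ?_⟩
  have h1 := Submodule.finrank_quotient_add_finrank ((coboundaries r (quotGrading I) 1
    (n : ℤ)).submoduleOf (cocycles r (quotGrading I) 1 (n : ℤ)))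
  rw [(Submodule.submoduleOfEquivOfLe (coboundaries_le_cocycles hG 1 n)).finrank_eq, hd2,
    hequiv.finrank_eq, hd1, hN (n + e') (by omega)] at h1
  exact h1

/-- The case of dimension at most one: since the Hilbert function grows strictly until it attains
its final value, `H^1(S/I)_n` vanishes for `n ≥ dim H^1(S/I)_0`. -/
theorem isBounded_of_ringKrullDim_le_one
    (hI : I.IsHomogeneous (homogeneousSubmodule (Fin r) k))
    (hsat : IsSaturated I) (hdim : ringKrullDim (MvPolynomial (Fin r) k ⧸ I) ≤ 1) (he : 0 < e)
    (hx : x.IsHomogeneous e) (hreg : ∀ s, x * s ∈ I → s ∈ I) {t : ℕ}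
    (ht : Module.rank k (localCoh r (quotGrading I) 1 0) ≤ t) :
    IsBounded I t fun _ => t := by
  obtain ⟨N, hN⟩ := exists_hilb_eq hI hsat hdim he hx hreg
  have hH := finrank_localCoh_one hI hsat hdim he hx hreg hN
  have hle : ∀ n, hilb I n ≤ hilb I N := fun n => by
    have := (hH n).2
    omega
  have ht0 : hilb I N ≤ t + hilb I 0 := by
    have h1 : Module.finrank k (localCoh r (quotGrading I) 1 0) + hilb I 0 = hilb I N := (hH 0).2
    have h2 := finrank_le_of_rank_le ht
    omega
  have htE : hilb I t = hilb I N := by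
    by_contra hne
    have hlt : ∀ i ≤ t, hilb I i < hilb I (i + 1) := by
      intro i hi
      refine lt_of_le_of_ne (hilb_le_succ hsat i) fun heq => hne ?_
      rw [hilb_eq_of_hilb_eq_succ hsat heq hi, ← hN (max N i) (le_max_left _ _),
        hilb_eq_of_hilb_eq_succ hsat heq (le_max_right _ _)]
    have hge : ∀ i ≤ t, hilb I 0 + i ≤ hilb I i := by
      intro i
      induction i with
      | zero => simp
      | succ i ih =>
        intro hi
        have h1 := ih (by omega)
        have h2 := hlt i (by omega)
        omega
    have h1 := hge t le_rfl
    have h2 := hle t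
    omega
  have hE : ∀ n, t ≤ n → hilb I n = hilb I N := fun n hn =>
    le_antisymm (hle n) (htE ▸ monotone_hilb hsat hn)
  refine ⟨fun p n hpn => ?_, fun n => ?_, fun n hn f hfI hf => ?_⟩
  · match p with
    | 0 => exact (cocycles_zero_eq_bot hsat n).trans_le bot_le
    | 1 =>
      lift n to ℕ using by push_cast at hpn; omega
      obtain ⟨hfin, hd⟩ := hH n
      rw [hE n (by push_cast at hpn; omega)] at hd
      have h0 : Module.finrank k (localCoh r (quotGrading I) 1 (n : ℤ)) = 0 := by omega
      exact subsingleton_subquot_iff.1 (Module.finrank_zero_iff.1 h0)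
    | p + 2 =>
      exact (isSection_top hI hdim hx hreg).cocycles_le_coboundaries he fun n' _ =>
        cocycles_top_le (p + 1) n'
  · obtain ⟨hfin, hd⟩ := hH n
    rw [← Module.finrank_eq_rank k]
    have h1 := monotone_hilb hsat (Nat.zero_le n)
    exact_mod_cast (show Module.finrank k (localCoh r (quotGrading I) 1 (n : ℤ)) ≤ t by omega)
  · obtain ⟨n, rfl⟩ : ∃ n', n = n' + 1 := ⟨n - 1, by omega⟩
    exact mem_genBy_of_hilb_eq hsat ((hE n (by omega)).trans (hE (n + 1) (by omega)).symm) hfI hf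

end DimensionOne

/-! ### The bounding polynomials -/

/-- The values `F_p(t)` at natural numbers `t`, by the same recursion; as for `F`, the value at
`p = 0` is a placeholder. -/
def natF (t : ℕ) : ℕ → ℕ
  | 0 => 0
  | 1 => t
  | p + 2 => natF t (p + 1) + t * (natF t (p + 1) + (p + 1)).choose (p + 1)

theorem eval_binomPoly (Y : Polynomial ℚ) (q n t : ℕ) (hY : Y.eval (t : ℚ) = n) :
    (binomPoly Y q).eval (t : ℚ) = ((n + q).choose q : ℕ) := by
  rw [binomPoly, Polynomial.eval_mul, Polynomial.eval_C, Polynomial.eval_comp, Polynomial.eval_add,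
    hY, Polynomial.eval_natCast, ← Nat.cast_add, descPochhammer_eval_eq_descFactorial,
    Nat.descFactorial_eq_factorial_mul_choose, Nat.cast_mul, inv_mul_cancel_left₀]
  exact_mod_cast q.factorial_ne_zero

theorem eval_F (t : ℕ) : ∀ p, (F p).eval (t : ℚ) = natF t p
  | 0 => by simp [F, natF]
  | 1 => by simp [F, natF]
  | p + 2 => by
    rw [F, natF, Polynomial.eval_add, Polynomial.eval_mul, Polynomial.eval_X,
      eval_binomPoly _ _ _ _ (eval_F t (p + 1)), eval_F t (p + 1)]
    push_cast
    rfl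

/-- The bounds for `dim H^1(S/I)_n` in consecutive dimensions satisfy the recursion of
`IsSection.isBounded`. -/
theorem mul_choose_eq_add_sum (t d n : ℕ) :
    t * (n + (d + 1)).choose (d + 1) =
      t + ∑ i ∈ Finset.range n, t * (i + 1 + d).choose d := by
  induction n with
  | zero => simp
  | succ n ih =>
    rw [Finset.sum_range_succ, ← add_assoc t, ← ih, ← mul_add,
      show n + 1 + (d + 1) = (n + 1 + d) + 1 by ring, Nat.choose_succ_succ,
      show n + (d + 1) = n + 1 + d by ring, add_comm (Nat.choose _ d)]

/-! ### Induction on the dimension -/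

section Induction

attribute [local instance] MvPolynomial.gradedAlgebra

theorem IsStdGraded.isHomogeneous {I : Ideal (MvPolynomial (Fin r) k)} (hI : IsStdGraded I) :
    I.IsHomogeneous (homogeneousSubmodule (Fin r) k) := by
  intro n f hf
  have := hI.1 f hf n
  rwa [← decomposition.decompose'_apply] at this

theorem IsStdGraded.le_maxIdeal {I : Ideal (MvPolynomial (Fin r) k)} (hI : IsStdGraded I) :
    I ≤ maxIdeal k r := by
  intro f hf
  have h0 := hI.1 f hf 0
  rw [homogeneousComponent_zero] at h0
  have hc : coeff 0 f = 0 := by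
    by_contra hne
    exact hI.2 (I.eq_top_of_isUnit_mem h0 ((isUnit_iff_ne_zero.2 hne).map C))
  rw [maxIdeal, ← Set.image_univ, mem_ideal_span_X_image]
  intro s hs
  have hs0 : s ≠ 0 := fun h => mem_support_iff.1 hs (h ▸ hc)
  obtain ⟨j, hj⟩ := Finsupp.ne_iff.1 hs0
  exact ⟨j, trivial, hj⟩

theorem isSection_saturation {I : Ideal (MvPolynomial (Fin r) k)} (hI : IsStdGraded I)
    {x : MvPolynomial (Fin r) k} (hx : x.IsHomogeneous 1)
    (hreg : IsRegular (Ideal.Quotient.mk I x)) :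
    IsSection I (saturation (I ⊔ Ideal.span {x})) x 1 where
  homogeneous := hI.isHomogeneous
  form := hx
  regular s hs := by
    rw [← Ideal.Quotient.eq_zero_iff_mem, map_mul] at hs
    exact Ideal.Quotient.eq_zero_iff_mem.1 (hreg.left (by simpa using hs))
  le f hf := ⟨0, fun g _ => Ideal.mul_mem_left _ g (Ideal.mem_sup_left hf)⟩
  mem := ⟨0, fun g _ => Ideal.mul_mem_left _ g
    (Ideal.mem_sup_right (Ideal.mem_span_singleton_self x))⟩
  torsion f hf j := by
    obtain ⟨a, ha⟩ := hf
    exact ⟨a, ha _ (Ideal.pow_mem_pow (Ideal.subset_span (Set.mem_range_self j)) a)⟩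

theorem IsBounded.mono {I : Ideal (MvPolynomial (Fin r) k)} {m m' : ℕ} {B B' : ℕ → ℕ}
    (h : IsBounded I m B) (hm : m ≤ m') (hB : ∀ n, B n ≤ B' n) : IsBounded I m' B' where
  vanish p n hpn := h.vanish p n (by omega)
  rank_le n := (h.rank_le n).trans (by exact_mod_cast hB n)
  gen n hn := h.gen n (by omega)

/-- The bounds on regularity and on the Hilbert function of `H^1`, by induction on a bound for the
dimension: a section by a regular linear form stays in the class after saturation. -/
theorem isBounded_of_ringKrullDim_le
    (C : (r : ℕ) → Set (Ideal (MvPolynomial (Fin r) k)))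
    (hC : ∀ (r : ℕ), ∀ I ∈ C r, IsStdGraded I)
    (hdepth : ∀ (r : ℕ), ∀ I ∈ C r, 0 < depth k r (MvPolynomial (Fin r) k ⧸ I))
    (hsection : ∀ (r : ℕ), ∀ I ∈ C r, 2 ≤ ringKrullDim (MvPolynomial (Fin r) k ⧸ I) →
      ∃ x : MvPolynomial (Fin r) k, x.IsHomogeneous 1 ∧ IsRegular (Ideal.Quotient.mk I x) ∧
        saturation (I ⊔ Ideal.span {x}) ∈ C r)
    (t : ℕ)
    (ht : ∀ (r : ℕ), ∀ I ∈ C r,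
      Module.rank k (localCoh r (quotGrading I) 1 0) ≤ t)
    (r d : ℕ) : ∀ I ∈ C r, ringKrullDim (MvPolynomial (Fin r) k ⧸ I) ≤ (d + 1 : ℕ) →
      IsBounded I (natF t (d + 1)) fun n => t * (n + d).choose d := by
  have hsat : ∀ I ∈ C r, IsSaturated I := by
    intro I hI
    obtain ⟨g, hgm, hg⟩ := exists_regular_of_depth_pos (hdepth r I hI)
    exact isSaturated_of_isSMulRegular hgm hg
  induction d with
  | zero =>
    intro I hI hd
    obtain ⟨g, hgm, hg⟩ := exists_regular_of_depth_pos (hdepth r I hI)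
    obtain ⟨e, f, he, hf, hfreg⟩ := exists_regular_form hgm hg
    simpa [natF] using isBounded_of_ringKrullDim_le_one (hC r I hI).isHomogeneous (hsat I hI)
      (by simpa using hd) he hf (fun s => mem_of_mul_mem_of_isSMulRegular hfreg) (ht r I hI)
  | succ d ih =>
    intro I hI hd
    by_cases h2 : 2 ≤ ringKrullDim (MvPolynomial (Fin r) k ⧸ I)
    · obtain ⟨x, hx, hreg, hJ⟩ := hsection r I hI h2
      have h := isSection_saturation (hC r I hI) hx hreg
      have hdim : ringKrullDim (MvPolynomial (Fin r) k ⧸ saturation (I ⊔ Ideal.span {x})) ≤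
          (d + 1 : ℕ) := by
        have h1 := (ringKrullDim_quotient_sup_span_add_one_le
          (mk_mem_nonZeroDivisors h.regular)).trans hd
        have h3 := ringKrullDim_le_of_surjective (Ideal.Quotient.factor
          (show I ⊔ Ideal.span {x} ≤ saturation (I ⊔ Ideal.span {x}) from
            sup_le h.le ((Ideal.span_singleton_le_iff_mem _).2 h.mem)))
          (Ideal.Quotient.factor_surjective _)
        refine h3.trans ?_
        generalize ringKrullDim (MvPolynomial (Fin r) k ⧸ I ⊔ Ideal.span {x}) = a at h1
        induction a using WithBot.recBotCoe with
        | bot => exact bot_le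
        | coe a =>
          have h4 : a + 1 ≤ ((d + 1 : ℕ) : ℕ∞) + 1 := by exact_mod_cast h1
          have h5 := (ENat.add_le_add_iff_right ENat.one_ne_top).1 h4
          exact_mod_cast h5
      exact h.isBounded (hsat I hI) (hsat _ hJ) (ih _ hJ hdim) (ht r I hI)
        fun n => mul_choose_eq_add_sum t d n
    · have h1 : ringKrullDim (MvPolynomial (Fin r) k ⧸ I) ≤ (d + 1 : ℕ) := by
        rw [not_le] at h2
        generalize ringKrullDim (MvPolynomial (Fin r) k ⧸ I) = a at h2
        induction a using WithBot.recBotCoe with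
        | bot => exact bot_le
        | coe a =>
          have h3 : a < 2 := WithBot.coe_lt_coe.1 h2
          lift a to ℕ using h3.ne_top
          have h4 : a < 2 := by exact_mod_cast h3
          exact_mod_cast (show a ≤ d + 1 by omega)
      refine (ih I hI h1).mono (Nat.le_add_right _ _) fun n => Nat.mul_le_mul_left t ?_
      rw [← add_assoc, Nat.choose_succ_succ]
      exact Nat.le_add_right _ _

end Induction

/-- A standard graded algebra of positive depth has positive dimension. -/
theorem ringKrullDim_ne_zero {I : Ideal (MvPolynomial (Fin r) k)} (hI : IsStdGraded I)
    (hdepth : 0 < depth k r (MvPolynomial (Fin r) k ⧸ I)) :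
    ringKrullDim (MvPolynomial (Fin r) k ⧸ I) ≠ 0 := by
  intro h0
  obtain ⟨g, hgm, hg⟩ := exists_regular_of_depth_pos hdepth
  have h1 := ringKrullDim_quotient_sup_span_add_one_le
    (mk_mem_nonZeroDivisors fun s => mem_of_mul_mem_of_isSMulRegular hg)
  have hne : I ⊔ Ideal.span {g} ≠ ⊤ := by
    refine ne_top_of_le_ne_top ?_ (sup_le hI.le_maxIdeal
      ((Ideal.span_singleton_le_iff_mem _).2 hgm))
    intro htop
    have h2 : (1 : MvPolynomial (Fin r) k) ∈ maxIdeal k r := htop ▸ trivial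
    rw [maxIdeal, ← Set.image_univ, mem_ideal_span_X_image] at h2
    obtain ⟨j, -, hj⟩ := h2 0 (by simp)
    exact hj rfl
  have := Ideal.Quotient.nontrivial_iff.2 hne
  have h2 := (add_le_add_left (ringKrullDim_nonneg_of_nontrivial
    (R := MvPolynomial (Fin r) k ⧸ I ⊔ Ideal.span {g})) 1).trans h1
  rw [h0, zero_add] at h2
  exact absurd h2 (by decide)

theorem IsBounded.reg_le {I : Ideal (MvPolynomial (Fin r) k)} {m : ℕ} {B : ℕ → ℕ}
    (h : IsBounded I m B) : reg r (quotGrading I) ≤ ((m : ℝ) : EReal) := by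
  refine iSup_le fun p => iSup_le fun n => iSup_le fun hnt => ?_
  rw [EReal.coe_le_coe_iff]
  by_contra hlt
  have h1 : (m : ℤ) < n + p := by exact_mod_cast not_le.1 hlt
  exact not_subsingleton _ (subsingleton_subquot_iff.2 (h.vanish p n h1))

end

end StdGraded

theorem theorem3p1 {k : Type*} [Field k]
    (C : (r : ℕ) → Set (Ideal (MvPolynomial (Fin r) k)))
    (hC : ∀ (r : ℕ), ∀ I ∈ C r, StdGraded.IsStdGraded I)
    (hdepth : ∀ (r : ℕ), ∀ I ∈ C r,
      0 < StdGraded.depth k r (MvPolynomial (Fin r) k ⧸ I))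
    (hsection : ∀ (r : ℕ), ∀ I ∈ C r, 2 ≤ ringKrullDim (MvPolynomial (Fin r) k ⧸ I) →
      ∃ x : MvPolynomial (Fin r) k, x.IsHomogeneous 1 ∧ IsRegular (Ideal.Quotient.mk I x) ∧
        StdGraded.saturation (I ⊔ Ideal.span {x}) ∈ C r)
    (t : ℕ)
    (ht : ∀ (r : ℕ), ∀ I ∈ C r,
      Module.rank k (StdGraded.localCoh r (StdGraded.quotGrading I) 1 0) ≤ t)
    (r : ℕ) (I : Ideal (MvPolynomial (Fin r) k)) (hI : I ∈ C r)
    (d : ℕ) (hd : ringKrullDim (MvPolynomial (Fin r) k ⧸ I) = d) :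
    StdGraded.reg r (StdGraded.quotGrading I) ≤
      ((((StdGraded.F d).eval (t : ℚ) : ℚ) : ℝ) : EReal) := by
  obtain _ | d := d
  · exact absurd (by simpa using hd)
      (StdGraded.ringKrullDim_ne_zero (hC r I hI) (hdepth r I hI))
  · rw [StdGraded.eval_F, Rat.cast_natCast]
    exact (StdGraded.isBounded_of_ringKrullDim_le C hC hdepth hsection t ht r d I hI
      hd.le).reg_le
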